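/- **Definitions.** A recursive tiling in $\mathbb{R}^d$ is given by finitely many rules. Each rule has a bounded region and divides it into finitely many pieces with pairwise disjoint interiors; each piece is the image, under a similarity transformation, of the region of some rule, and is subdivided recursively by the transformed rule. The region of a designated rule is the unit tile $U$. All regions obtained on all levels of recursion, starting from $U$, are the tiles. The tiling is rectangular if all tiles are axis-parallel boxes. Its Arrwwid number is the smallest number $a$ for which there is a constant $c$ such that every ball $Q\subseteq U$ can be covered by at most $a$ tiles with total volume at most $c\cdot\mathrm{volume}(Q)$. The Daun tiling is the recursive tiling with a single rule, with unit tile $[0,3]\times[0,2]$, that divides this rectangle into 16 rectangles similar to it with scale factor $\frac14$. In units of $\frac14$ (so that the unit tile becomes $[0,12]\times[0,8]$ and the pieces have sides 3 and 2), the pieces have lower left corner $(a,b)$ and are rotated over $q$ counterclockwise quarter turns, where $(a,b;q)$ is one of $(0,0;0)$, $(3,0;2)$, $(6,0;0)$, $(9,0;2)$, $(0,2;1)$, $(2,2;0)$, $(5,2;3)$, $(7,2;2)$, $(10,2;1)$, $(2,4;0)$, $(7,4;2)$, $(0,5;3)$, $(5,5;1)$, $(10,5;3)$, $(2,6;0)$,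 $(7,6;2)$. For $d\ge 2$ and $h_1,\dots,h_{d-2}>0$, the $d$-dimensional lifted Daun tiling has unit tile $[0,3]\times[0,2]\times[0,h_1]\times\dots\times[0,h_{d-2}]$. It is obtained from the Daun tiling by adding $d-2$ dimensions one at a time: when a dimension of height $h$ is added, every region $R$ becomes $R\times[0,h]$, which is divided into four equal layers, each of which is subdivided, in the old coordinates, as before; the transformations act on the old coordinates as before and map $[0,h]$ onto $[lh/4,(l+1)h/4]$ by $z\mapsto (z+lh)/4$ in layer $l\in\{0,1,2,3\}$. **Theorem.** (1) For every $h>0$, the three-dimensional lifted Daun tiling with height $h$ is a rectangular recursive tiling that divides each box into 64 boxes; these are organised into four equal layers of 16 boxes each, such that each layer consists of the products of the 16 rectangles of the Daun tiling with the extent of that layer. Its Arrwwid number is six. (2) For every $d\ge 2$ and all heights $h_1,\dots,h_{d-2}>0$, the $d$-dimensional lifted Daun tiling is a rectangular recursive tiling with Arrwwid number $3\cdot 2^{d-2}$. -/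

import Mathlib

open Set MeasureTheory
open scoped NNReal ENNReal

noncomputable section

/-- `d`-dimensional Euclidean space. -/
abbrev Space (d : ℕ) : Type := EuclideanSpace ℝ (Fin d)

/-- The data of a recursive tiling in `d` dimensions. Each rule `r` has a region `region r`,
which is cut into pieces indexed by `Piece r`; the piece `p` is the image of the region of the rule
`next r p` under the transformation `place r p`, and it is subdivided further by the rule `next r p`
transformed by `place r p`. The region of the rule `root` is the unit tile.
The requirements on these data are in `RecursiveTiling.IsValid`. -/
structure RecursiveTiling (d : ℕ) where
  Rule : Type
  root : Rule
  region : Rule → Set (Space d)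
  Piece : Rule → Type
  next : (r : Rule) → Piece r → Rule
  place : (r : Rule) → Piece r → Space d → Space d

namespace RecursiveTiling

variable {d : ℕ}

/-- The piece `p` in the subdivision of the region of the rule `r`. -/
def piece (T : RecursiveTiling d) (r : T.Rule) (p : T.Piece r) : Set (Space d) :=
  T.place r p '' T.region (T.next r p)

/-- The data define a recursive tiling: there are finitely many rules, every rule has finitely many
pieces, the regions are bounded (and closed, with interior points), the transformations
are similarities, and the pieces of each rule tile the region of that rule, that is, they have
pairwise disjoint interiors and their union is the region. -/
structure IsValid (T : RecursiveTiling d) : Prop where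
  finite_rule : Finite T.Rule
  finite_piece : ∀ r, Finite (T.Piece r)
  isCompact_region : ∀ r, IsCompact (T.region r)
  interior_nonempty : ∀ r, (interior (T.region r)).Nonempty
  similarity : ∀ r p, ∃ ρ : ℝ, 0 < ρ ∧ ∀ x y, dist (T.place r p x) (T.place r p y) = ρ * dist x y
  iUnion_piece : ∀ r, ⋃ p, T.piece r p = T.region r
  disjoint_interior : ∀ r, ∀ p q : T.Piece r, p ≠ q →
    Disjoint (interior (T.piece r p)) (interior (T.piece r q))

/-- The unit tile. -/
def unitTile (T : RecursiveTiling d) : Set (Space d) := T.region T.root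

/-- The tiles that `k` levels of subdivision produce from the region of the rule `r`. -/
def tilesFrom (T : RecursiveTiling d) : ℕ → T.Rule → Set (Set (Space d))
  | 0, r => {T.region r}
  | k + 1, r => {t | ∃ p : T.Piece r, ∃ s ∈ T.tilesFrom k (T.next r p), t = T.place r p '' s}

/-- The tiles on level `k`: the unit tile is the only tile on level `0`. -/
def levelTiles (T : RecursiveTiling d) (k : ℕ) : Set (Set (Space d)) := T.tilesFrom k T.root

/-- All tiles of the recursive tiling, on all levels of recursion. -/
def tiles (T : RecursiveTiling d) : Set (Set (Space d)) := ⋃ k, T.levelTiles k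

/-- `t` is an axis-parallel box with sides of positive length. -/
def IsBox (t : Set (Space d)) : Prop :=
  ∃ a b : Fin d → ℝ, (∀ i, a i < b i) ∧ t = {x | ∀ i, x i ∈ Icc (a i) (b i)}

/-- All tiles are axis-parallel boxes. -/
def IsRectangular (T : RecursiveTiling d) : Prop := ∀ t ∈ T.tiles, IsBox t

/-- Every ball `Q` that lies in the unit tile can be covered by at most `a` tiles
with total volume at most `c * volume Q`. -/
def CoversBalls (T : RecursiveTiling d) (a : ℕ) (c : ℝ≥0) : Prop :=
  ∀ (x : Space d) (r : ℝ), 0 < r → Metric.closedBall x r ⊆ T.unitTile →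
    ∃ F : Finset (Set (Space d)), (∀ t ∈ F, t ∈ T.tiles) ∧ F.card ≤ a ∧
      Metric.closedBall x r ⊆ ⋃ t ∈ F, t ∧
      ∑ t ∈ F, volume t ≤ (c : ℝ≥0∞) * volume (Metric.closedBall x r)

/-- The Arrwwid number is `a`: this is the smallest number for which there is a constant `c`
such that every ball `Q` in the unit tile is covered by at most `a` tiles
of total volume at most `c * volume Q`. -/
def HasArrwwidNumber (T : RecursiveTiling d) (a : ℕ) : Prop :=
  IsLeast {a' : ℕ | ∃ c : ℝ≥0, T.CoversBalls a' c} a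

/-- The first `d` coordinates of a point in `d + 1` dimensions. -/
def dropLast (x : Space (d + 1)) : Space d := WithLp.toLp 2 fun i => x i.castSucc

/-- The point with first `d` coordinates `x` and last coordinate `z`. -/
def appendLast (x : Space d) (z : ℝ) : Space (d + 1) :=
  WithLp.toLp 2 (Fin.snoc (α := fun _ => ℝ) (fun i => x i) z)

/-- The prism `t × [lo, hi]`. -/
def prism (t : Set (Space d)) (lo hi : ℝ) : Set (Space (d + 1)) :=
  {x | dropLast x ∈ t ∧ x (Fin.last d) ∈ Icc lo hi}

/-- Lifting a recursive tiling, whose transformations scale by `1 / k`, by one dimension: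
the regions become prisms of height `h`, divided into `k` equal layers, such that each layer, seen
from above, shows the original subdivision. In the first `d` coordinates the transformations are
those of the original tiling; in the new coordinate they scale `[0, h]` to the extent
`[l * h / k, (l + 1) * h / k]` of layer `l`. -/
def lift (T : RecursiveTiling d) (k : ℕ) (h : ℝ) : RecursiveTiling (d + 1) where
  Rule := T.Rule
  root := T.root
  region r := prism (T.region r) 0 h
  Piece r := T.Piece r × Fin k
  next r p := T.next r p.1
  place r p x := appendLast (T.place r p.1 (dropLast x)) ((x (Fin.last d) + (p.2 : ℕ) * h) / k)

end RecursiveTiling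

/-- The sixteen tiles in the rule of the Daun tiling, in units of a quarter of the unit of length:
the rectangle `[0, 12] × [0, 8]` is divided into rectangles of size `3 × 2`, rotated over
`q` quarter turns. An entry `(a, b, q)` gives the lower left corner `(a, b)` of the tile as placed
and the number `q` of counterclockwise quarter turns. -/
def daunTable : Fin 16 → ℕ × ℕ × Fin 4 :=
  ![(0, 0, 0), (3, 0, 2), (6, 0, 0), (9, 0, 2),
    (0, 2, 1), (2, 2, 0), (5, 2, 3), (7, 2, 2), (10, 2, 1),
    (2, 4, 0), (7, 4, 2),
    (0, 5, 3), (5, 5, 1), (10, 5, 3),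
    (2, 6, 0), (7, 6, 2)]

/-- The rectangle `[0, 3] × [0, 2]` rotated counterclockwise over `q` quarter turns,
and then translated so that its lower left corner is the origin again. -/
def quarterTurns (q : Fin 4) (u v : ℝ) : ℝ × ℝ :=
  ![(u, v), (2 - v, u), (3 - u, 2 - v), (v, 3 - u)] q

/-- The Daun tiling: a recursive tiling with one rule, which divides the rectangle
`[0, 3] × [0, 2]` into sixteen rectangles that are similar to it, with scale factor `1 / 4`. -/
def daunTiling : RecursiveTiling 2 where
  Rule := Unit
  root := ()
  region _ := {x | x 0 ∈ Icc (0 : ℝ) 3 ∧ x 1 ∈ Icc (0 : ℝ) 2}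
  Piece _ := Fin 16
  next _ _ := ()
  place _ i x :=
    !₂[(((daunTable i).1 : ℝ) + (quarterTurns (daunTable i).2.2 (x 0) (x 1)).1) / 4,
       (((daunTable i).2.1 : ℝ) + (quarterTurns (daunTable i).2.2 (x 0) (x 1)).2) / 4]

/-- The Daun tiling lifted `n` times, each time with four layers, to dimension `2 + n`;
the unit tile is the box with sides of length `3, 2, h 0, …, h (n - 1)`. -/
def liftedDaunTiling : (n : ℕ) → (Fin n → ℝ) → RecursiveTiling (2 + n)
  | 0, _ => daunTiling
  | n + 1, h => (liftedDaunTiling n fun i => h i.castSucc).lift 4 (h (Fin.last n))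

end

/-! The Arrwwid number is determined by two local quantities, both of which double under lifting.

Upper bound (`LocallyCovers`): if balls of radius at most `ρ / k ^ n` are covered by `a` tiles of
level `n`, then a ball of radius `r` is matched with the level where `k ^ n` is comparable to `ρ /
r`. Tiles of that level have diameter `O(r)`, hence volume `O(r ^ d)`.

Lower bound (`HasVertex`): let `a` first-level pieces have private points arbitrarily close to an
interior point `v` of the unit tile. A tiny ball around `v` cannot afford the unit tile, every other
tile lies in a single first-level piece, and so `a` tiles are needed.

Under `lift`, level `n` becomes a stack of `k ^ n` copies of the old level `n`. A small ball meets
at most two layers, and a vertex placed on the boundary of layers 0 and 1 acquires private points in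
both. This gives the factor 2 per added dimension.

It remains to get 3 for the Daun tiling. Three pieces meet at `(3 / 4, 1 / 2)`. For the upper bound,
level `k` is drawn on a grid of unit cells; a small ball meets at most a 2 by 2 block of cells, and
this block lies in at most three tiles unless four tiles meet at its centre. That never happens, by
induction on the level: the type of a cell (orientation of its tile, position in it) determines the
types of its 16 subcells, and relations `Beside` and `Below` between neighbouring types are
preserved by subdivision and rule out new crossings. There are only 24 types, so each induction step
is a finite check. -/

noncomputable section

/-! ### Criterion for the Arrwwid number: small-scale covers and vertices -/

namespace RecursiveTiling

variable {d : ℕ}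

/-- All transformations scale distances by the factor `1 / k`. -/
def IsScaled (T : RecursiveTiling d) (k : ℕ) : Prop :=
  ∀ r p x y, dist (T.place r p x) (T.place r p y) = (1 / k : ℝ) * dist x y

/-- A ball whose radius is small, compared to the tiles of level `n` of a tiling with scale
factor `1 / k`, can be covered by `a` tiles of level `n`. -/
def LocallyCovers (T : RecursiveTiling d) (k a : ℕ) : Prop :=
  ∃ ρ : ℝ, 0 < ρ ∧ ∀ (n : ℕ) (x : Space d) (r : ℝ), 0 < r → r * k ^ n ≤ ρ →
    Metric.closedBall x r ⊆ T.unitTile →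
    ∃ F : Finset (Set (Space d)), (∀ t ∈ F, t ∈ T.levelTiles n) ∧ F.card ≤ a ∧
      Metric.closedBall x r ⊆ ⋃ t ∈ F, t

/-- There is an interior point of the unit tile such that, arbitrarily close to it,
`a` different pieces of the unit tile have points that are in no other piece. -/
def HasVertex (T : RecursiveTiling d) (a : ℕ) : Prop :=
  ∃ v : Space d, T.unitTile ∈ nhds v ∧ ∀ ε : ℝ, 0 < ε →
    ∃ S : Finset (T.Piece T.root), S.card = a ∧ ∀ s ∈ S, ∃ y ∈ Metric.closedBall v ε,
      ∀ q, y ∈ T.piece T.root q → q = s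

theorem IsScaled.continuous {T : RecursiveTiling d} {k : ℕ} (hT : T.IsScaled k)
    (r : T.Rule) (p : T.Piece r) : Continuous (T.place r p) := by
  have : LipschitzWith (1 / k : ℝ≥0) (T.place r p) := by
    refine LipschitzWith.of_dist_le_mul fun x y => ?_
    rw [hT r p x y]
    simp
  exact this.continuous

theorem tilesFrom_subset_region {T : RecursiveTiling d} (hT : T.IsValid) (n : ℕ) (r : T.Rule)
    {t : Set (Space d)} (ht : t ∈ T.tilesFrom n r) : t ⊆ T.region r := by
  induction n generalizing r t with
  | zero => exact (show t = T.region r from ht).le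
  | succ n ih =>
    obtain ⟨p, s, hs, rfl⟩ := ht
    rw [← hT.iUnion_piece r]
    exact (image_mono (ih _ hs)).trans (subset_iUnion (T.piece r) p)

theorem exists_piece_of_mem_levelTiles_succ {T : RecursiveTiling d} (hT : T.IsValid) (n : ℕ)
    {t : Set (Space d)} (ht : t ∈ T.levelTiles (n + 1)) : ∃ p, t ⊆ T.piece T.root p := by
  obtain ⟨p, s, hs, rfl⟩ := ht
  exact ⟨p, image_mono (tilesFrom_subset_region hT n _ hs)⟩

/-- The diameters of the tiles of level `n` are at most a constant times `1 / k ^ n`. -/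
theorem exists_dist_le_of_mem_levelTiles {T : RecursiveTiling d} {k : ℕ} (hT : T.IsValid)
    (hs : T.IsScaled k) : ∃ D : ℝ, 0 < D ∧ ∀ n, ∀ t ∈ T.levelTiles n, ∀ x ∈ t, ∀ y ∈ t,
      dist x y ≤ D / k ^ n := by
  have hfin := hT.finite_rule
  have key : ∃ D : ℝ, 0 < D ∧ ∀ r, ∀ x ∈ T.region r, ∀ y ∈ T.region r, dist x y ≤ D := by
    have hb : ∀ r, ∃ D : ℝ, ∀ x ∈ T.region r, ∀ y ∈ T.region r, dist x y ≤ D := fun r => by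
      obtain ⟨D, hD⟩ := Metric.isBounded_iff.1 (hT.isCompact_region r).isBounded
      exact ⟨D, fun x hx y hy => hD hx hy⟩
    choose D hD using hb
    obtain ⟨M, hM⟩ := (finite_range D).bddAbove
    refine ⟨max M 1, by positivity, fun r x hx y hy => (hD r x hx y hy).trans ?_⟩
    exact (hM (mem_range_self r)).trans (le_max_left _ _)
  obtain ⟨D, hD0, hD⟩ := key
  refine ⟨D, hD0, fun n => ?_⟩
  suffices h : ∀ r, ∀ t ∈ T.tilesFrom n r, ∀ x ∈ t, ∀ y ∈ t, dist x y ≤ D / k ^ n from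
    h T.root
  induction n with
  | zero =>
    intro r t ht x hx y hy
    obtain rfl : t = T.region r := ht
    simpa using hD r x hx y hy
  | succ n ih =>
    rintro r t ⟨p, s, hs', rfl⟩ _ ⟨x, hx, rfl⟩ _ ⟨y, hy, rfl⟩
    rw [hs r p x y]
    calc (1 / k : ℝ) * dist x y ≤ (1 / k : ℝ) * (D / k ^ n) := by
          gcongr; exact ih _ s hs' x hx y hy
      _ = D / k ^ (n + 1) := by rw [pow_succ, div_mul_div_comm, one_mul, mul_comm (k : ℝ)]

/-- Choosing the level so that tile size is comparable to the radius turns a bound on the number of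
tiles into a bound on their volume. -/
theorem LocallyCovers.exists_coversBalls {T : RecursiveTiling d} {k a : ℕ} (hT : T.IsValid)
    (hs : T.IsScaled k) (hk : 1 < k) (ha : 0 < a) (h : T.LocallyCovers k a) :
    ∃ c : ℝ≥0, T.CoversBalls a c := by
  obtain ⟨ρ, hρ, h⟩ := h
  obtain ⟨D, hD0, hD⟩ := exists_dist_le_of_mem_levelTiles hT hs
  have hk' : (1 : ℝ) < k := by exact_mod_cast hk
  -- At the chosen level `ρ < r * k ^ (n + 1)`, so the diameter bound `D / k ^ n` is at most `M *
  -- r`. Each tile then fits in a ball of radius `M * r`, whence the factor `M ^ d`.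
  set M : ℝ := k * D / ρ with hM
  have hM0 : 0 < M := by positivity
  refine ⟨a * (M ^ d).toNNReal, fun x r hr hx => ?_⟩
  have key : ∃ n, D / k ^ n ≤ M * r ∧
      ∃ F : Finset (Set (Space d)), (∀ t ∈ F, t ∈ T.levelTiles n) ∧ F.card ≤ a ∧
      Metric.closedBall x r ⊆ ⋃ t ∈ F, t := by
    rcases le_or_gt r ρ with hle | hlt
    · obtain ⟨n, h1, h2⟩ := exists_nat_pow_near (x := ρ / r) (y := (k : ℝ))
        ((one_le_div hr).2 hle) hk'
      refine ⟨n, ?_, h n x r hr ?_ hx⟩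
      · rw [hM, div_le_iff₀ (by positivity)]
        rw [div_lt_iff₀ hr] at h2
        rw [show k * D / ρ * r * k ^ n = D * (k ^ (n + 1) * r) / ρ by ring, le_div_iff₀ hρ]
        gcongr
      · rw [le_div_iff₀ hr] at h1
        linarith
    -- A ball of radius above `ρ` is so large that the unit tile alone is affordable.
    · refine ⟨0, ?_, {T.unitTile}, ?_, by simpa using Nat.succ_le_of_lt ha, by simpa using hx⟩
      · rw [pow_zero, div_one, hM, div_mul_eq_mul_div, le_div_iff₀ hρ]
        have : D * ρ ≤ D * r := by gcongr
        have h2 : 1 * (D * r) ≤ k * (D * r) := by gcongr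
        linarith
      · intro t ht
        rw [Finset.mem_singleton] at ht
        exact ht
  obtain ⟨n, hn, F, hF, hcard, hcov⟩ := key
  refine ⟨F, fun t ht => mem_iUnion.2 ⟨n, hF t ht⟩, hcard, hcov, ?_⟩
  have hvol : ∀ t ∈ F, volume t ≤
      ((M ^ d).toNNReal : ℝ≥0∞) * volume (Metric.closedBall x r) := by
    intro t ht
    rcases t.eq_empty_or_nonempty with rfl | ⟨y, hy⟩
    · simp
    have hsub : t ⊆ Metric.closedBall y (M * r) := fun z hz =>
      Metric.mem_closedBall.2 ((hD n t (hF t ht) z hz y hy).trans hn)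
    refine (measure_mono hsub).trans (le_of_eq ?_)
    rw [Measure.addHaar_closedBall_mul volume y hM0.le hr.le, finrank_euclideanSpace_fin,
      Measure.addHaar_closedBall_center volume x]
    rfl
  calc ∑ t ∈ F, volume t ≤
        ∑ t ∈ F, ((M ^ d).toNNReal : ℝ≥0∞) * volume (Metric.closedBall x r) :=
        Finset.sum_le_sum hvol
    _ = F.card * (((M ^ d).toNNReal : ℝ≥0∞) * volume (Metric.closedBall x r)) := by
        rw [Finset.sum_const, nsmul_eq_mul]
    _ ≤ a * (((M ^ d).toNNReal : ℝ≥0∞) * volume (Metric.closedBall x r)) := by gcongr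
    _ = _ := by push_cast; ring

/-- For a ball too small to pay for the unit tile, sending each of the `a` pieces to a covering tile
that contains its private point is injective. -/
theorem HasVertex.le_of_coversBalls {T : RecursiveTiling d} {a a' : ℕ} {c : ℝ≥0} (hd : 0 < d)
    (hT : T.IsValid) (h : T.HasVertex a) (hc : T.CoversBalls a' c) : a ≤ a' := by
  obtain ⟨v, hv, h⟩ := h
  obtain ⟨δ, hδ, hball⟩ := Metric.nhds_basis_closedBall.mem_iff.1 hv
  have hU : 0 < volume T.unitTile := Measure.measure_pos_of_mem_nhds volume hv
  have hlim : Filter.Tendsto (fun r : ℝ => (c : ℝ≥0∞) * volume (Metric.closedBall v r))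
      (nhdsWithin 0 (Ioi 0)) (nhds 0) := by
    have h1 : Filter.Tendsto (fun r : ℝ => (c : ℝ≥0∞) * (ENNReal.ofReal (r ^ d) *
        volume (Metric.ball (0 : Space d) 1))) (nhds 0) (nhds 0) := by
      have h2 : Filter.Tendsto (fun r : ℝ => ENNReal.ofReal (r ^ d)) (nhds 0) (nhds 0) := by
        have : Continuous fun r : ℝ => ENNReal.ofReal (r ^ d) :=
          ENNReal.continuous_ofReal.comp (continuous_pow d)
        simpa [hd.ne'] using this.tendsto 0
      have h3 := ENNReal.Tendsto.mul_const (b := volume (Metric.ball (0 : Space d) 1)) h2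
        (Or.inr measure_ball_lt_top.ne)
      have h4 := ENNReal.Tendsto.const_mul (a := (c : ℝ≥0∞)) h3 (Or.inr ENNReal.coe_ne_top)
      simpa using h4
    refine (h1.mono_left nhdsWithin_le_nhds).congr' ?_
    filter_upwards [self_mem_nhdsWithin] with r hr
    rw [Measure.addHaar_closedBall volume v (le_of_lt hr), finrank_euclideanSpace_fin]
  have hIoo : ∀ᶠ r in nhdsWithin (0 : ℝ) (Ioi 0), r ∈ Ioo 0 δ := Ioo_mem_nhdsGT hδ
  obtain ⟨r, hr1, hr2⟩ := ((hlim.eventually (gt_mem_nhds hU)).and hIoo).exists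
  have hr3 : 0 < r := hr2.1
  have hsub : Metric.closedBall v r ⊆ T.unitTile :=
    (Metric.closedBall_subset_closedBall hr2.2.le).trans hball
  obtain ⟨F, hF, hcard, hcov, hvol⟩ := hc v r hr3 hsub
  obtain ⟨S, rfl, hS⟩ := h r hr3
  refine le_trans ?_ hcard
  -- Uniqueness of `q` alone would hold vacuously for the unit tile; the existence of some `q` is
  -- what makes `t` determine `s`, and it uses that `t` is not on level 0.
  have key : ∀ s ∈ S, ∃ t ∈ F, (∃ q, t ⊆ T.piece T.root q) ∧
      ∀ q, t ⊆ T.piece T.root q → q = s := by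
    intro s hs
    obtain ⟨y, hy, hyq⟩ := hS s hs
    obtain ⟨t, ht, hyt⟩ := mem_iUnion₂.1 (hcov hy)
    refine ⟨t, ht, ?_, fun q hq => hyq q (hq hyt)⟩
    obtain ⟨n, hn⟩ := mem_iUnion.1 (hF t ht)
    cases n with
    | succ n => exact exists_piece_of_mem_levelTiles_succ hT n hn
    | zero =>
      obtain rfl : t = T.unitTile := hn
      have h1 : volume T.unitTile ≤ ∑ t ∈ F, volume t :=
        Finset.single_le_sum (f := fun t => volume t) (fun _ _ => bot_le) ht
      exact absurd (h1.trans hvol) (not_le.2 hr1)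
  choose! g hgF hgq hg using key
  refine Finset.card_le_card_of_injOn g hgF fun s hs s' hs' hss => ?_
  obtain ⟨q, hq⟩ := hgq s hs
  rw [← hg s hs q hq, hg s' hs' q (hss ▸ hq)]

theorem hasArrwwidNumber_of_locallyCovers_of_hasVertex {T : RecursiveTiling d} {k a : ℕ}
    (hd : 0 < d) (hk : 1 < k) (ha : 0 < a) (hT : T.IsValid) (hs : T.IsScaled k)
    (hcov : T.LocallyCovers k a) (hv : T.HasVertex a) : T.HasArrwwidNumber a :=
  ⟨hcov.exists_coversBalls hT hs hk ha, fun _ ⟨_, hc⟩ => hv.le_of_coversBalls hd hT hc⟩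

end RecursiveTiling

/-! ### Lifting by one dimension -/

namespace RecursiveTiling

variable {d : ℕ}

@[simp]
theorem dropLast_appendLast (x : Space d) (z : ℝ) : dropLast (appendLast x z) = x := by
  ext i
  simp [dropLast, appendLast]

@[simp]
theorem appendLast_last (x : Space d) (z : ℝ) : appendLast x z (Fin.last d) = z := by
  simp [appendLast]

@[simp]
theorem appendLast_castSucc (x : Space d) (z : ℝ) (i : Fin d) :
    appendLast x z i.castSucc = x i := by
  simp [appendLast]

@[simp]
theorem appendLast_dropLast (x : Space (d + 1)) : appendLast (dropLast x) (x (Fin.last d)) = x := by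
  ext i
  refine Fin.lastCases ?_ (fun j => ?_) i <;> simp [dropLast]

theorem mem_prism {t : Set (Space d)} {lo hi : ℝ} {x : Space (d + 1)} :
    x ∈ prism t lo hi ↔ dropLast x ∈ t ∧ x (Fin.last d) ∈ Icc lo hi := Iff.rfl

@[simp]
theorem appendLast_mem_prism {t : Set (Space d)} {lo hi : ℝ} {x : Space d} {z : ℝ} :
    appendLast x z ∈ prism t lo hi ↔ x ∈ t ∧ z ∈ Icc lo hi := by
  simp [mem_prism]

theorem dist_sq_eq (x y : Space (d + 1)) :
    dist x y ^ 2 = dist (dropLast x) (dropLast y) ^ 2 +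
      (x (Fin.last d) - y (Fin.last d)) ^ 2 := by
  rw [EuclideanSpace.dist_eq, EuclideanSpace.dist_eq, Real.sq_sqrt (by positivity),
    Real.sq_sqrt (by positivity), Fin.sum_univ_castSucc, Real.dist_eq (x _), sq_abs]
  rfl

theorem dist_dropLast_le (x y : Space (d + 1)) : dist (dropLast x) (dropLast y) ≤ dist x y := by
  refine le_of_sq_le_sq ?_ dist_nonneg
  rw [dist_sq_eq x y]
  linarith [sq_nonneg (x (Fin.last d) - y (Fin.last d))]

theorem abs_last_sub_le (x y : Space (d + 1)) :
    |x (Fin.last d) - y (Fin.last d)| ≤ dist x y := by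
  refine abs_le_of_sq_le_sq ?_ dist_nonneg
  rw [dist_sq_eq x y]
  linarith [sq_nonneg (dist (dropLast x) (dropLast y))]

theorem continuous_dropLast : Continuous (dropLast : Space (d + 1) → Space d) :=
  (LipschitzWith.of_dist_le_mul (K := 1) fun x y => by simpa using dist_dropLast_le x y).continuous

theorem continuous_appendLast : Continuous fun x : Space d × ℝ => appendLast x.1 x.2 := by
  refine (PiLp.continuous_toLp 2 _).comp ?_
  refine continuous_pi fun i => ?_
  refine Fin.lastCases ?_ (fun j => ?_) i
  · simpa using continuous_snd
  · simp only [Fin.snoc_castSucc]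
    fun_prop

theorem isCompact_prism {t : Set (Space d)} (ht : IsCompact t) (lo hi : ℝ) :
    IsCompact (prism t lo hi) := by
  convert (ht.prod (isCompact_Icc (a := lo) (b := hi))).image continuous_appendLast using 1
  ext x
  constructor
  · exact fun hx => ⟨(dropLast x, x (Fin.last d)), hx, by simp⟩
  · rintro ⟨y, hy, rfl⟩
    simpa using hy

/-- An open subset of the prism has open slices through each of its points, horizontally and
vertically; conversely the right-hand side is open. -/
theorem interior_prism (t : Set (Space d)) (lo hi : ℝ) : interior (prism t lo hi) =
    {x | dropLast x ∈ interior t ∧ x (Fin.last d) ∈ Ioo lo hi} := by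
  apply Subset.antisymm
  · intro x hx
    constructor
    · have hc : Continuous fun y : Space d => appendLast y (x (Fin.last d)) :=
        continuous_appendLast.comp (continuous_id.prodMk continuous_const)
      refine mem_interior.2 ⟨_, fun y hy => ?_,
        (isOpen_interior (s := prism t lo hi)).preimage hc, ?_⟩
      · exact (appendLast_mem_prism.1 (interior_subset hy)).1
      · simpa using hx
    · have hc : Continuous fun z : ℝ => appendLast (dropLast x) z :=
        continuous_appendLast.comp (continuous_const.prodMk continuous_id)
      rw [← interior_Icc]
      refine mem_interior.2 ⟨_, fun y hy => ?_,
        (isOpen_interior (s := prism t lo hi)).preimage hc, ?_⟩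
      · exact (appendLast_mem_prism.1 (interior_subset hy)).2
      · simpa using hx
  · refine interior_maximal (fun x hx => ⟨interior_subset hx.1, Ioo_subset_Icc_self hx.2⟩) ?_
    exact (isOpen_interior.preimage continuous_dropLast).inter
      (isOpen_Ioo.preimage (by fun_prop : Continuous fun x : Space (d + 1) => x (Fin.last d)))

theorem IsBox.prism {t : Set (Space d)} (ht : IsBox t) {lo hi : ℝ} (h : lo < hi) :
    IsBox (prism t lo hi) := by
  obtain ⟨a, b, hab, rfl⟩ := ht
  refine ⟨Fin.snoc (α := fun _ => ℝ) a lo, Fin.snoc (α := fun _ => ℝ) b hi, ?_, ?_⟩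
  · intro i
    refine Fin.lastCases ?_ (fun j => ?_) i <;> simp [h, hab]
  · ext x
    simp only [mem_prism, mem_ofPred_eq, Fin.forall_fin_succ', Fin.snoc_castSucc, Fin.snoc_last]
    rfl

theorem lift_place_image_prism (T : RecursiveTiling d) {k : ℕ} (hk : 0 < k) (h : ℝ) (r : T.Rule)
    (p : T.Piece r) (l : Fin k) (t : Set (Space d)) (lo hi : ℝ) :
    (T.lift k h).place r (p, l) '' prism t lo hi =
      prism (T.place r p '' t) ((lo + (l : ℕ) * h) / k) ((hi + (l : ℕ) * h) / k) := by
  have hk' : (0 : ℝ) < k := by exact_mod_cast hk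
  ext x
  constructor
  · rintro ⟨y, hy, rfl⟩
    have h1 := hy.2.1
    have h2 := hy.2.2
    refine appendLast_mem_prism.2 ⟨mem_image_of_mem _ hy.1, ?_, ?_⟩ <;> gcongr
  · rintro ⟨⟨y, hy, hyx⟩, h1, h2⟩
    rw [div_le_iff₀ hk'] at h1
    rw [le_div_iff₀ hk'] at h2
    refine ⟨appendLast y (x (Fin.last d) * k - (l : ℕ) * h), ?_, ?_⟩
    · exact appendLast_mem_prism.2 ⟨hy, by linarith, by linarith⟩
    · simp only [lift, dropLast_appendLast, appendLast_last, sub_add_cancel, hyx]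
      rw [mul_div_cancel_right₀ _ hk'.ne', appendLast_dropLast]

theorem lift_piece (T : RecursiveTiling d) {k : ℕ} (hk : 0 < k) (h : ℝ) (r : T.Rule)
    (p : T.Piece r) (l : Fin k) : (T.lift k h).piece r (p, l) =
      prism (T.piece r p) ((l : ℕ) * h / k) (((l : ℕ) + 1) * h / k) := by
  refine (lift_place_image_prism T hk h r p l _ 0 h).trans ?_
  rw [zero_add, add_mul, one_mul, add_comm h]
  rfl

/-- Layer numbers are written in base `k`: the outermost step supplies the leading digit `l`, the
deeper ones the remainder `m`, giving layer `l * k ^ n + m`. Every layer thus carries all tiles of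
the level. -/
theorem lift_tilesFrom (T : RecursiveTiling d) {k : ℕ} (hk : 0 < k) (h : ℝ) (n : ℕ) (r : T.Rule) :
    (T.lift k h).tilesFrom n r = {s | ∃ t ∈ T.tilesFrom n r, ∃ l < k ^ n,
      s = prism t (l * h / k ^ n) ((l + 1) * h / k ^ n)} := by
  have hk' : (0 : ℝ) < k := by exact_mod_cast hk
  induction n generalizing r with
  | zero =>
    ext s
    simp [tilesFrom, lift]
  | succ n ih =>
    have layer : ∀ (l m : ℕ), ((m : ℝ) * h / k ^ n + l * h) / k =
        ((l * k ^ n + m : ℕ) : ℝ) * h / k ^ (n + 1) := by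
      intro l m
      push_cast
      field_simp
      ring
    have layer' : ∀ (l m : ℕ), (((m : ℝ) + 1) * h / k ^ n + l * h) / k =
        (((l * k ^ n + m : ℕ) : ℝ) + 1) * h / k ^ (n + 1) := by
      intro l m
      push_cast
      field_simp
      ring
    ext s
    constructor
    · rintro ⟨⟨p, l⟩, u, hu, rfl⟩
      obtain ⟨t, ht, m, hm, rfl⟩ := (ih (T.next r p)).subset hu
      refine ⟨_, ⟨p, t, ht, rfl⟩, l * k ^ n + m, ?_, ?_⟩
      · calc (l : ℕ) * k ^ n + m < (l + 1) * k ^ n := by linarith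
          _ ≤ k * k ^ n := Nat.mul_le_mul_right _ l.2
          _ = k ^ (n + 1) := by ring
      · rw [lift_place_image_prism T hk, layer, layer']
    · rintro ⟨_, ⟨p, t, ht, rfl⟩, m, hm, rfl⟩
      have hkn : 0 < k ^ n := by positivity
      refine ⟨(p, ⟨m / k ^ n, (Nat.div_lt_iff_lt_mul hkn).2 (by rwa [← pow_succ'])⟩), _,
        (ih (T.next r p)).superset ⟨t, ht, m % k ^ n, Nat.mod_lt _ hkn, rfl⟩, ?_⟩
      rw [lift_place_image_prism T hk, layer, layer', Nat.div_add_mod']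

theorem lift_levelTiles (T : RecursiveTiling d) {k : ℕ} (hk : 0 < k) (h : ℝ) (n : ℕ) :
    (T.lift k h).levelTiles n = {s | ∃ t ∈ T.levelTiles n, ∃ l < k ^ n,
      s = prism t (l * h / k ^ n) ((l + 1) * h / k ^ n)} :=
  lift_tilesFrom T hk h n T.root

theorem IsRectangular.lift {T : RecursiveTiling d} (hT : T.IsRectangular) {k : ℕ} (hk : 0 < k)
    {h : ℝ} (hh : 0 < h) : (T.lift k h).IsRectangular := by
  have hk' : (0 : ℝ) < k := by exact_mod_cast hk
  intro s hs
  obtain ⟨n, hn⟩ := mem_iUnion.1 hs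
  rw [lift_levelTiles T hk] at hn
  obtain ⟨t, ht, l, -, rfl⟩ := hn
  refine (hT t (mem_iUnion.2 ⟨n, ht⟩)).prism ?_
  gcongr
  linarith

/-- By Pythagoras: the old coordinates and the new one are both scaled by `1 / k`, so the lifted
maps are again similarities. -/
theorem IsScaled.lift {T : RecursiveTiling d} {k : ℕ} (hT : T.IsScaled k) (h : ℝ) :
    (T.lift k h).IsScaled k := by
  rintro r ⟨p, l⟩ x y
  have h0 : (0 : ℝ) ≤ (1 / k : ℝ) * dist x y := by positivity
  refine (sq_eq_sq₀ dist_nonneg h0).1 ?_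
  rw [mul_pow, dist_sq_eq x y, dist_sq_eq]
  simp only [RecursiveTiling.lift, dropLast_appendLast, appendLast_last, hT r p]
  ring

theorem IsValid.lift {T : RecursiveTiling d} (hT : T.IsValid) {k : ℕ} (hk : 0 < k)
    (hs : T.IsScaled k) {h : ℝ} (hh : 0 < h) : (T.lift k h).IsValid where
  finite_rule := hT.finite_rule
  finite_piece r := by
    have := hT.finite_piece r
    exact inferInstanceAs (Finite (T.Piece r × Fin k))
  isCompact_region r := isCompact_prism (hT.isCompact_region r) 0 h
  interior_nonempty r := by
    obtain ⟨x, hx⟩ := hT.interior_nonempty r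
    have h2 : h / 2 ∈ Ioo 0 h := ⟨by linarith, by linarith⟩
    refine ⟨appendLast x (h / 2), (interior_prism (T.region r) 0 h).superset ?_⟩
    simpa using And.intro hx h2
  similarity r p := ⟨1 / k, by positivity, hs.lift h r p⟩
  iUnion_piece r := by
    have hk' : (0 : ℝ) < k := by exact_mod_cast hk
    refine Subset.antisymm (iUnion_subset ?_) ?_
    · rintro ⟨p, l⟩
      refine (lift_piece T hk h r p l).trans_subset ?_
      rintro x ⟨h1, h2, h3⟩
      refine ⟨(hT.iUnion_piece r).subset (mem_iUnion.2 ⟨p, h1⟩), le_trans (by positivity) h2,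
        h3.trans ?_⟩
      rw [div_le_iff₀ hk', mul_comm h]
      gcongr
      exact_mod_cast l.2
    · rintro x ⟨h1, h2, h3⟩
      obtain ⟨p, hp⟩ := mem_iUnion.1 ((hT.iUnion_piece r).superset h1)
      set z := x (Fin.last d) with hz
      have h0 : 0 ≤ z * k / h := by positivity
      rcases lt_or_ge ⌊z * k / h⌋₊ k with hlt | hge
      · refine mem_iUnion.2 ⟨(p, ⟨⌊z * k / h⌋₊, hlt⟩), ?_⟩
        refine (lift_piece T hk h r p _).superset ⟨hp, ?_, ?_⟩
        · rw [div_le_iff₀ hk', ← le_div_iff₀ hh]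
          exact Nat.floor_le h0
        · rw [le_div_iff₀ hk', ← div_le_iff₀ hh]
          exact (Nat.lt_floor_add_one _).le
      -- Only the top face reaches this case: there the floor is `k`, and the last layer `k - 1` is
      -- used instead.
      · have hge' : (k : ℝ) ≤ z * k / h := (Nat.le_floor_iff h0).1 hge
        rw [le_div_iff₀ hh, mul_comm, mul_le_mul_iff_left₀ hk'] at hge'
        refine mem_iUnion.2 ⟨(p, ⟨k - 1, Nat.sub_lt hk one_pos⟩), ?_⟩
        have : ((k - 1 : ℕ) : ℝ) = k - 1 := by rw [Nat.cast_sub hk, Nat.cast_one]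
        refine (lift_piece T hk h r p _).superset ⟨hp, ?_, ?_⟩
        · rw [div_le_iff₀ hk']
          simp only [this]
          nlinarith
        · rw [le_div_iff₀ hk']
          simp only [this]
          nlinarith
  disjoint_interior r := by
    have hk' : (0 : ℝ) < k := by exact_mod_cast hk
    rintro ⟨p, l⟩ ⟨q, m⟩ hne
    rw [Set.disjoint_left]
    intro x hx hy
    obtain ⟨h1, h2, h3⟩ := (interior_prism _ _ _).subset
      (interior_mono (lift_piece T hk h r p l).subset hx)
    obtain ⟨h4, h5, h6⟩ := (interior_prism _ _ _).subset
      (interior_mono (lift_piece T hk h r q m).subset hy)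
    by_cases hpq : p = q
    · subst hpq
      have h7 := h2.trans h6
      have h8 := h5.trans h3
      rw [div_lt_div_iff_of_pos_right hk', mul_lt_mul_iff_left₀ hh] at h7 h8
      refine hne ?_
      congr 1
      ext
      have h7' : (l : ℕ) < (m : ℕ) + 1 := by exact_mod_cast h7
      have h8' : (m : ℕ) < (l : ℕ) + 1 := by exact_mod_cast h8
      omega
    · exact Set.disjoint_left.1 (hT.disjoint_interior r p q hpq) h1 h4

theorem LocallyCovers.lift {T : RecursiveTiling d} {k a : ℕ} (hk : 0 < k)
    (hT : T.LocallyCovers k a) {h : ℝ} (hh : 0 < h) : (T.lift k h).LocallyCovers k (2 * a) := by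
  classical
  have hk' : (0 : ℝ) < k := by exact_mod_cast hk
  obtain ⟨ρ, hρ, hT⟩ := hT
  -- With `h / 2` the ball is at most as high as one layer of level `n`, so it meets only the layer
  -- `m` of its lowest point and the next one.
  refine ⟨min ρ (h / 2), by positivity, fun n x r hr hle hx => ?_⟩
  have hkn : (0 : ℝ) < (k : ℝ) ^ n := by positivity
  -- Purely horizontal and purely vertical displacements stay in the ball; they give the projected
  -- ball in the base tile and the bounds on `z - r` and `z + r`.
  have hball : ∀ y ∈ Metric.closedBall (dropLast x) r, ∀ z, y = dropLast x ∨ z = x (Fin.last d) →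
      |z - x (Fin.last d)| ≤ r → y ∈ T.unitTile ∧ z ∈ Icc 0 h := by
    intro y hy z hyz hz
    refine appendLast_mem_prism.1 (hx (Metric.mem_closedBall.2 ?_))
    refine le_of_sq_le_sq ?_ hr.le
    rw [dist_sq_eq, dropLast_appendLast, appendLast_last]
    rcases hyz with rfl | rfl
    · rw [dist_self, ← sq_abs (z - _)]
      have := pow_le_pow_left₀ (abs_nonneg _) hz 2
      linarith
    · have := pow_le_pow_left₀ dist_nonneg (Metric.mem_closedBall.1 hy) 2
      linarith
  obtain ⟨F, hF, hcard, hcov⟩ := hT n (dropLast x) r hr (hle.trans (min_le_left _ _))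
    fun y hy => (hball y hy _ (Or.inr rfl) (by simpa using hr.le)).1
  have hlow := (hball _ (Metric.mem_closedBall_self hr.le) (x (Fin.last d) - r) (Or.inl rfl)
    (by simp [abs_of_pos hr])).2.1
  have hhigh := (hball _ (Metric.mem_closedBall_self hr.le) (x (Fin.last d) + r) (Or.inl rfl)
    (by simp [abs_of_pos hr])).2.2
  set z := x (Fin.last d) with hz
  have hle' : r * k ^ n ≤ h / 2 := hle.trans (min_le_right _ _)
  set m := ⌊(z - r) * k ^ n / h⌋₊ with hm
  have hm1 : m * h ≤ (z - r) * k ^ n := by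
    rw [← le_div_iff₀ hh]
    exact Nat.floor_le (by positivity)
  have hm2 : (z - r) * k ^ n < (m + 1) * h := by
    rw [← div_lt_iff₀ hh]
    exact Nat.lt_floor_add_one _
  have lt_of_lt : ∀ (l : ℕ) (c : ℝ), c ≤ h → l * h < c * k ^ n → l < k ^ n := by
    intro l c hc hl
    have : l * h < k ^ n * h := by nlinarith
    exact_mod_cast lt_of_mul_lt_mul_right this hh.le
  -- The filter discards layer `m + 1` when `m` is already the top layer.
  refine ⟨(F ×ˢ ({l ∈ {m, m + 1} | l < k ^ n} : Finset ℕ)).image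
    fun s => prism s.1 (s.2 * h / k ^ n) ((s.2 + 1) * h / k ^ n), ?_, ?_, ?_⟩
  · intro s hs
    obtain ⟨⟨t, l⟩, htl, rfl⟩ := Finset.mem_image.1 hs
    obtain ⟨ht, hl⟩ := Finset.mem_product.1 htl
    rw [lift_levelTiles T hk]
    exact ⟨t, hF t ht, l, (Finset.mem_filter.1 hl).2, rfl⟩
  · refine Finset.card_image_le.trans ?_
    rw [Finset.card_product, mul_comm]
    exact Nat.mul_le_mul ((Finset.card_filter_le _ _).trans Finset.card_le_two) hcard
  · intro y hy
    obtain ⟨t, ht, hyt⟩ := mem_iUnion₂.1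
      (hcov (Metric.mem_closedBall.2 ((dist_dropLast_le y x).trans (Metric.mem_closedBall.1 hy))))
    have hyz := abs_le.1 ((abs_last_sub_le y x).trans (Metric.mem_closedBall.1 hy))
    set c := y (Fin.last d) with hc
    have hc1 : (z - r) * k ^ n ≤ c * k ^ n := by
      gcongr
      linarith
    have hc2 : c * k ^ n ≤ (z - r) * k ^ n + h := by
      have : c * k ^ n ≤ (z + r) * k ^ n := by
        gcongr
        linarith
      linarith
    have hch : c ≤ h := by linarith
    have key : ∃ l ∈ ({l ∈ {m, m + 1} | l < k ^ n} : Finset ℕ),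
        l * h ≤ c * k ^ n ∧ c * k ^ n ≤ (l + 1) * h := by
      rcases le_or_gt (c * k ^ n) ((m + 1) * h) with hcm | hcm
      · refine ⟨m, ?_, by linarith, hcm⟩
        simp only [Finset.mem_filter, Finset.mem_insert, true_or, true_and]
        exact lt_of_lt m (z + r) hhigh (by nlinarith)
      · refine ⟨m + 1, ?_, by push_cast; linarith, by push_cast; linarith⟩
        simp only [Finset.mem_filter, Finset.mem_insert, Finset.mem_singleton, or_true, true_and]
        exact lt_of_lt (m + 1) c hch (by push_cast; exact hcm)
    obtain ⟨l, hl, hl1, hl2⟩ := key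
    refine mem_iUnion₂.2 ⟨_, Finset.mem_image_of_mem _ (Finset.mk_mem_product ht hl), hyt, ?_, ?_⟩
    · exact (div_le_iff₀ hkn).2 hl1
    · exact (le_div_iff₀ hkn).2 hl2

theorem HasVertex.lift {T : RecursiveTiling d} {k a : ℕ} (hk : 1 < k)
    (hT : T.HasVertex a) {h : ℝ} (hh : 0 < h) : (T.lift k h).HasVertex (2 * a) := by
  obtain ⟨v, hv, hT⟩ := hT
  have hk' : (1 : ℝ) < k := by exact_mod_cast hk
  refine ⟨appendLast v (h / k), ?_, fun ε hε => ?_⟩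
  · rw [← mem_interior_iff_mem_nhds] at hv ⊢
    refine (interior_prism (T.region T.root) 0 h).superset ⟨?_, ?_⟩
    · rw [dropLast_appendLast]
      exact hv
    · rw [appendLast_last]
      exact ⟨by positivity, div_lt_self hh hk'⟩
  · change ∃ S : Finset (T.Piece T.root × Fin k), S.card = 2 * a ∧ _
    obtain ⟨S, hS, hy⟩ := hT (ε / 2) (by positivity)
    -- At most half a layer, so that `h / k - δ` and `h / k + δ` are interior to layers 0 and 1; `ε
    -- / 2` in each direction keeps the total displacement below `ε`.
    set δ := min (ε / 2) (h / (2 * k)) with hδ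
    have hδ0 : 0 < δ := by positivity
    have hδ1 : δ ≤ ε / 2 := min_le_left _ _
    have hδ2 : δ * k ≤ h / 2 := by
      have : δ * k ≤ h / (2 * k) * k := by
        gcongr
        exact min_le_right _ _
      rwa [show h / (2 * k) * k = h / 2 by field_simp] at this
    let e : Fin 2 ↪ Fin k := Fin.castLEEmb hk
    refine ⟨S ×ˢ Finset.univ.map e, ?_, ?_⟩
    · rw [Finset.card_product, Finset.card_map, hS, Finset.card_univ, Fintype.card_fin, mul_comm]
    · rintro ⟨s, l⟩ hsl
      obtain ⟨hs, hl⟩ := Finset.mem_product.1 hsl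
      obtain ⟨y, hyv, hys⟩ := hy s hs
      obtain ⟨i, -, rfl⟩ := Finset.mem_map.1 hl
      have key : ∃ z : ℝ, |z - h / k| ≤ ε / 2 ∧
          ∀ m : ℕ, m * h ≤ z * k → z * k ≤ (m + 1) * h → m = (i : ℕ) := by
        have hhk : h / k * k = h := div_mul_cancel₀ _ (by positivity)
        have hδk : 0 < δ * k := by positivity
        fin_cases i
        · refine ⟨h / k - δ, ?_, fun m h1 h2 => ?_⟩
          · rw [sub_sub_cancel_left, abs_neg, abs_of_pos hδ0]
            exact hδ1
          · rw [sub_mul, hhk] at h1 h2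
            have : (m : ℝ) * h < 1 * h := by linarith
            have h3 : m < 1 := by exact_mod_cast lt_of_mul_lt_mul_right this hh.le
            simpa using h3
        · refine ⟨h / k + δ, ?_, fun m h1 h2 => ?_⟩
          · rw [add_sub_cancel_left, abs_of_pos hδ0]
            exact hδ1
          · rw [add_mul, hhk] at h1 h2
            have h3 : (m : ℝ) * h < 2 * h := by linarith
            have h4 : 1 * h < ((m : ℝ) + 1) * h := by linarith
            have h5 : m < 2 := by exact_mod_cast lt_of_mul_lt_mul_right h3 hh.le
            have h6 : 1 < m + 1 := by exact_mod_cast lt_of_mul_lt_mul_right h4 hh.le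
            show m = 1
            omega
      obtain ⟨z, hz1, hz2⟩ := key
      refine ⟨appendLast y z, ?_, ?_⟩
      · refine Metric.mem_closedBall.2 (le_of_sq_le_sq ?_ hε.le)
        rw [dist_sq_eq]
        simp only [dropLast_appendLast, appendLast_last]
        have h1 := pow_le_pow_left₀ dist_nonneg (Metric.mem_closedBall.1 hyv) 2
        have h2 := pow_le_pow_left₀ (abs_nonneg _) hz1 2
        rw [sq_abs] at h2
        nlinarith
      · rintro ⟨q, m⟩ hq
        obtain ⟨h1, h2, h3⟩ := appendLast_mem_prism.1 ((lift_piece T (by omega) h _ q m).subset hq)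
        obtain rfl := hys q h1
        congr 1
        ext
        rw [div_le_iff₀ (by positivity)] at h2
        rw [le_div_iff₀ (by positivity)] at h3
        exact hz2 m h2 h3

end RecursiveTiling

/-! ### Placed tiles of the Daun tiling in integer coordinates -/

/-- The width of the rectangle `[0, 3] × [0, 2]` after `q` quarter turns. -/
def turnedWidth (q : Fin 4) : ℕ := ![3, 2, 3, 2] q

/-- The height of the rectangle `[0, 3] × [0, 2]` after `q` quarter turns. -/
def turnedHeight (q : Fin 4) : ℕ := ![2, 3, 2, 3] q

/-- The lower left corner of piece `p` in the subdivision of a tile that has been rotated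
over `q` quarter turns, relative to the lower left corner of that tile. -/
def childCorner (q : Fin 4) (p : Fin 16) : ℕ × ℕ :=
  let a := (daunTable p).1
  let b := (daunTable p).2.1
  let r := (daunTable p).2.2
  ![(a, b), (8 - b - turnedHeight r, a), (12 - a - turnedWidth r, 8 - b - turnedHeight r),
    (b, 12 - a - turnedWidth r)] q

/-- Rotation over `q` quarter turns, followed by the translation over `(A, B)` and scaling by
`1 / 4 ^ k`. -/
def tileMap (k : ℕ) (q : Fin 4) (A B : ℝ) (x : Space 2) : Space 2 :=
  !₂[(A + (quarterTurns q (x 0) (x 1)).1) / 4 ^ k, (B + (quarterTurns q (x 0) (x 1)).2) / 4 ^ k]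

/-- The rectangle on level `k` with lower left corner `(A, B)` and orientation `q`, in units of
`1 / 4 ^ k`. -/
def tileBox (k : ℕ) (q : Fin 4) (A B : ℝ) : Set (Space 2) :=
  {x | x 0 ∈ Icc (A / 4 ^ k) ((A + turnedWidth q) / 4 ^ k) ∧
    x 1 ∈ Icc (B / 4 ^ k) ((B + turnedHeight q) / 4 ^ k)}

theorem turnedWidth_pos (q : Fin 4) : 0 < turnedWidth q := by revert q; decide

theorem turnedHeight_pos (q : Fin 4) : 0 < turnedHeight q := by revert q; decide

theorem daunTable_add_le (p : Fin 16) :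
    (daunTable p).1 + turnedWidth (daunTable p).2.2 ≤ 12 ∧
      (daunTable p).2.1 + turnedHeight (daunTable p).2.2 ≤ 8 := by
  revert p; decide

theorem tileMap_image_region (k : ℕ) (q : Fin 4) (A B : ℝ) :
    tileMap k q A B '' daunTiling.region () = tileBox k q A B := by
  have hk : (0 : ℝ) < 4 ^ k := by positivity
  ext y
  constructor
  · rintro ⟨x, ⟨⟨h1, h2⟩, h3, h4⟩, rfl⟩
    constructor <;> constructor <;> simp only [tileMap, PiLp.toLp_apply,
      Matrix.cons_val_zero, Matrix.cons_val_one] <;> gcongr <;> fin_cases q <;>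
      simp [quarterTurns, turnedWidth, turnedHeight] <;> linarith
  · rintro ⟨⟨h1, h2⟩, h3, h4⟩
    rw [div_le_iff₀ hk] at h1 h3
    rw [le_div_iff₀ hk] at h2 h4
    set u := y 0 * 4 ^ k - A with hu
    set v := y 1 * 4 ^ k - B with hv
    have hy : !₂[(A + u) / 4 ^ k, (B + v) / 4 ^ k] = y := by
      ext i
      fin_cases i
      · simp [hu]
      · simp [hv]
    fin_cases q <;> simp [turnedWidth, turnedHeight] at h2 h4
    · refine ⟨!₂[u, v], ⟨⟨?_, ?_⟩, ?_, ?_⟩, ?_⟩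
      pick_goal 5
      · rw [← hy]
        simp [tileMap, quarterTurns]
      all_goals (simp; linarith)
    · refine ⟨!₂[v, 2 - u], ⟨⟨?_, ?_⟩, ?_, ?_⟩, ?_⟩
      pick_goal 5
      · rw [← hy]
        simp [tileMap, quarterTurns]
      all_goals (simp; linarith)
    · refine ⟨!₂[3 - u, 2 - v], ⟨⟨?_, ?_⟩, ?_, ?_⟩, ?_⟩
      pick_goal 5
      · rw [← hy]
        simp [tileMap, quarterTurns]
      all_goals (simp; linarith)
    · refine ⟨!₂[3 - v, u], ⟨⟨?_, ?_⟩, ?_, ?_⟩, ?_⟩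
      pick_goal 5
      · rw [← hy]
        simp [tileMap, quarterTurns]
      all_goals (simp; linarith)

/-- The second turn acts on a rectangle that has already been turned, hence the sides `turnedWidth
r` and `turnedHeight r` in place of 3 and 2. -/
theorem quarterTurns_add (q r : Fin 4) (u v : ℝ) : quarterTurns (q + r) u v =
    ![((quarterTurns r u v).1, (quarterTurns r u v).2),
      (turnedHeight r - (quarterTurns r u v).2, (quarterTurns r u v).1),
      (turnedWidth r - (quarterTurns r u v).1, turnedHeight r - (quarterTurns r u v).2),
      ((quarterTurns r u v).2, turnedWidth r - (quarterTurns r u v).1)] q := by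
  fin_cases q <;> fin_cases r <;> simp [quarterTurns, turnedWidth, turnedHeight]

/-- Composing a placement with a rule adds the orientations and refines the corner by a factor 4, so
the placement of every tile is described by integers. -/
theorem tileMap_place (k : ℕ) (q : Fin 4) (A B : ℝ) (p : Fin 16) (x : Space 2) :
    tileMap k q A B (daunTiling.place () p x) =
      tileMap (k + 1) (q + (daunTable p).2.2) (4 * A + (childCorner q p).1)
        (4 * B + (childCorner q p).2) x := by
  obtain ⟨h1, h2⟩ := daunTable_add_le p
  have e1 : ((12 - (daunTable p).1 - turnedWidth (daunTable p).2.2 : ℕ) : ℝ) =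
      12 - (daunTable p).1 - turnedWidth (daunTable p).2.2 := by
    rw [Nat.cast_sub (by omega), Nat.cast_sub (by omega)]
    rfl
  have e2 : ((8 - (daunTable p).2.1 - turnedHeight (daunTable p).2.2 : ℕ) : ℝ) =
      8 - (daunTable p).2.1 - turnedHeight (daunTable p).2.2 := by
    rw [Nat.cast_sub (by omega), Nat.cast_sub (by omega)]
    rfl
  ext i
  simp only [tileMap, quarterTurns_add q]
  fin_cases q <;> fin_cases i <;>
    simp [daunTiling, childCorner, quarterTurns, e1, e2] <;> ring

theorem place_eq_tileMap (p : Fin 16) : daunTiling.place () p =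
    tileMap 1 (daunTable p).2.2 (daunTable p).1 (daunTable p).2.1 := by
  funext x
  simp [tileMap, daunTiling]

theorem tileMap_zero (x : Space 2) : tileMap 0 0 0 0 x = x := by
  ext i
  fin_cases i <;> simp [tileMap, quarterTurns]

theorem daunTiling_piece (p : Fin 16) : daunTiling.piece () p =
    tileBox 1 (daunTable p).2.2 (daunTable p).1 (daunTable p).2.1 := by
  rw [← tileMap_image_region, ← place_eq_tileMap]
  rfl

theorem isBox_tileBox (k : ℕ) (q : Fin 4) (A B : ℝ) : RecursiveTiling.IsBox (tileBox k q A B) := by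
  have h1 : (0 : ℝ) < turnedWidth q := by exact_mod_cast turnedWidth_pos q
  have h2 : (0 : ℝ) < turnedHeight q := by exact_mod_cast turnedHeight_pos q
  refine ⟨![A / 4 ^ k, B / 4 ^ k],
    ![(A + turnedWidth q) / 4 ^ k, (B + turnedHeight q) / 4 ^ k], ?_, ?_⟩
  · simp only [Fin.forall_fin_two, Matrix.cons_val_zero, Matrix.cons_val_one]
    constructor <;> gcongr <;> linarith
  · ext x
    simp [tileBox, Fin.forall_fin_two]

theorem daunTiling_isRectangular : daunTiling.IsRectangular := by
  intro t ht
  obtain ⟨n, hn⟩ := mem_iUnion.1 ht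
  -- Generalised over an outer placement, since the recursion of `tilesFrom` peels off the outermost
  -- map, which is absorbed into `tileMap`.
  suffices h : ∀ (n k : ℕ) (q : Fin 4) (A B : ℝ), ∀ s ∈ daunTiling.tilesFrom n (),
      RecursiveTiling.IsBox (tileMap k q A B '' s) by
    have := h n 0 0 0 0 t hn
    rwa [funext tileMap_zero, image_id'] at this
  intro n
  induction n with
  | zero =>
    intro k q A B s hs
    obtain rfl : s = daunTiling.region () := hs
    rw [tileMap_image_region]
    exact isBox_tileBox k q A B
  | succ n ih =>
    rintro k q A B _ ⟨p, s, hs, rfl⟩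
    rw [image_image, image_congr fun x _ => tileMap_place k q A B p x]
    exact ih _ _ _ _ s hs

/-- Applying the map `tileMap k q A B` to the tiles of level `m` gives tiles of level `k + m`. -/
def IsPlacement (k : ℕ) (q : Fin 4) (A B : ℝ) : Prop :=
  ∀ m, ∀ s ∈ daunTiling.tilesFrom m (), tileMap k q A B '' s ∈ daunTiling.tilesFrom (k + m) ()

theorem isPlacement_zero : IsPlacement 0 0 0 0 := by
  intro m s hs
  rwa [funext tileMap_zero, image_id', zero_add]

/-- Refinement happens innermost while `tilesFrom` unfolds from outside; this is why `IsPlacement`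
quantifies over all depths `m`, here used at `m + 1`. -/
theorem IsPlacement.succ {k : ℕ} {q : Fin 4} {A B : ℝ} (h : IsPlacement k q A B) (p : Fin 16) :
    IsPlacement (k + 1) (q + (daunTable p).2.2) (4 * A + (childCorner q p).1)
      (4 * B + (childCorner q p).2) := by
  intro m s hs
  have := h (m + 1) (daunTiling.place () p '' s) ⟨p, s, hs, rfl⟩
  rwa [image_image, image_congr fun x _ => tileMap_place k q A B p x,
    ← add_assoc, add_right_comm] at this

theorem IsPlacement.tileBox_mem {k : ℕ} {q : Fin 4} {A B : ℝ} (h : IsPlacement k q A B) :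
    tileBox k q A B ∈ daunTiling.levelTiles k := by
  rw [← tileMap_image_region]
  exact h 0 _ rfl

theorem daunTiling_isScaled : daunTiling.IsScaled 4 := by
  intro r (p : Fin 16) x y
  change dist (daunTiling.place () p x) (daunTiling.place () p y) = _
  have h0 : (0 : ℝ) ≤ (1 / (4 : ℕ) : ℝ) * dist x y := by positivity
  refine (sq_eq_sq₀ dist_nonneg h0).1 ?_
  rw [mul_pow, EuclideanSpace.dist_eq, EuclideanSpace.dist_eq, Real.sq_sqrt (by positivity),
    Real.sq_sqrt (by positivity), Fin.sum_univ_two, Fin.sum_univ_two, place_eq_tileMap]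
  simp only [Real.dist_eq, sq_abs, tileMap]
  generalize (daunTable p).2.2 = q
  fin_cases q <;> simp [quarterTurns] <;> ring

/-! ### Validity of the Daun tiling and its vertex of degree three -/

theorem interior_preimage_coord (i : Fin 2) (s : Set ℝ) :
    interior {x : Space 2 | x i ∈ s} = {x | x i ∈ interior s} := by
  have hs : Function.Surjective (EuclideanSpace.proj i : Space 2 →L[ℝ] ℝ) := fun z =>
    ⟨EuclideanSpace.single i z, by simp⟩
  exact (((EuclideanSpace.proj i : Space 2 →L[ℝ] ℝ).isOpenMap
    hs).preimage_interior_eq_interior_preimage (ContinuousLinearMap.continuous _) s).symm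

theorem interior_rectangle (a b a' b' : ℝ) :
    interior {x : Space 2 | x 0 ∈ Icc a b ∧ x 1 ∈ Icc a' b'} =
      {x | x 0 ∈ Ioo a b ∧ x 1 ∈ Ioo a' b'} := by
  change interior ({x : Space 2 | x 0 ∈ Icc a b} ∩ {x : Space 2 | x 1 ∈ Icc a' b'}) = _
  rw [interior_inter, interior_preimage_coord, interior_preimage_coord, interior_Icc,
    interior_Icc]
  rfl

/-- An interval of length at most one half meets at most two consecutive integer cells. -/
theorem exists_two_cells {M : ℕ} {lo hi : ℝ} (h0 : 0 ≤ lo) (hM : lo < M) (hlo : hi ≤ lo + 1 / 2)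
    (hhi : hi ≤ M) : ∃ i i' : ℕ, (i' = i ∨ i' = i + 1) ∧ i < M ∧ i' < M ∧
      ∀ z ∈ Icc lo hi, z ∈ Icc (i : ℝ) (i + 1) ∨ z ∈ Icc (i' : ℝ) (i' + 1) := by
  have h1 : (⌊lo⌋₊ : ℝ) ≤ lo := Nat.floor_le h0
  have h2 : lo < ⌊lo⌋₊ + 1 := Nat.lt_floor_add_one lo
  have hlt : ⌊lo⌋₊ < M := (Nat.floor_lt h0).2 hM
  by_cases h : ⌊lo⌋₊ + 1 < M
  · refine ⟨⌊lo⌋₊, ⌊lo⌋₊ + 1, Or.inr rfl, hlt, h, fun z hz => ?_⟩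
    rcases le_or_gt z (⌊lo⌋₊ + 1) with hle | hgt
    · exact Or.inl ⟨h1.trans hz.1, hle⟩
    · exact Or.inr ⟨by push_cast; exact hgt.le, by push_cast; linarith [hz.2]⟩
  · have : (M : ℝ) ≤ ⌊lo⌋₊ + 1 := by exact_mod_cast not_lt.1 h
    exact ⟨⌊lo⌋₊, ⌊lo⌋₊, Or.inl rfl, hlt, hlt, fun z hz =>
      Or.inl ⟨h1.trans hz.1, hz.2.trans (hhi.trans this)⟩⟩

theorem exists_cell {M : ℕ} (hM : 0 < M) {z : ℝ} (h0 : 0 ≤ z) (hz : z ≤ M) :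
    ∃ i < M, z ∈ Icc (i : ℝ) (i + 1) := by
  rcases hz.lt_or_eq with hlt | rfl
  · obtain ⟨i, i', -, hi, hi', h⟩ := exists_two_cells h0 hlt (by linarith : z ≤ z + 1 / 2) hz
    rcases h z ⟨le_rfl, le_rfl⟩ with h | h
    exacts [⟨i, hi, h⟩, ⟨i', hi', h⟩]
  · refine ⟨M - 1, by omega, ?_⟩
    rw [Nat.cast_sub hM]
    simp

/-- Pieces are unions of unit cells, so that they cover the tile is a check of 96 cells. -/
theorem exists_piece_of_cell : ∀ i < 12, ∀ j < 8, ∃ p : Fin 16,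
    ((daunTable p).1 ≤ i ∧ i + 1 ≤ (daunTable p).1 + turnedWidth (daunTable p).2.2) ∧
    (daunTable p).2.1 ≤ j ∧ j + 1 ≤ (daunTable p).2.1 + turnedHeight (daunTable p).2.2 := by
  decide +kernel

theorem pieces_separated : ∀ p q : Fin 16, p ≠ q →
    (daunTable p).1 + turnedWidth (daunTable p).2.2 ≤ (daunTable q).1 ∨
    (daunTable q).1 + turnedWidth (daunTable q).2.2 ≤ (daunTable p).1 ∨
    (daunTable p).2.1 + turnedHeight (daunTable p).2.2 ≤ (daunTable q).2.1 ∨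
    (daunTable q).2.1 + turnedHeight (daunTable q).2.2 ≤ (daunTable p).2.1 := by
  decide +kernel

theorem mem_tileBox_one {q : Fin 4} {A B : ℝ} {x : Space 2} : x ∈ tileBox 1 q A B ↔
    x 0 * 4 ∈ Icc A (A + turnedWidth q) ∧ x 1 * 4 ∈ Icc B (B + turnedHeight q) := by
  have h4 : (0 : ℝ) < 4 := by norm_num
  simp [tileBox, div_le_iff₀ h4, le_div_iff₀ h4]

theorem daunTiling_isValid : daunTiling.IsValid where
  finite_rule := inferInstanceAs (Finite Unit)
  finite_piece _ := inferInstanceAs (Finite (Fin 16))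
  isCompact_region r := by
    convert (isCompact_univ_pi fun i : Fin 2 =>
      isCompact_Icc (a := (![0, 0] : Fin 2 → ℝ) i) (b := (![3, 2] : Fin 2 → ℝ) i)).image
        (PiLp.continuous_toLp 2 _) using 1
    ext x
    constructor
    · intro hx
      refine ⟨x.ofLp, fun i _ => ?_, rfl⟩
      fin_cases i
      exacts [hx.1, hx.2]
    · rintro ⟨y, hy, rfl⟩
      exact ⟨hy 0 trivial, hy 1 trivial⟩
  interior_nonempty r := by
    refine ⟨!₂[1, 1], (interior_rectangle 0 3 0 2).superset ?_⟩
    simp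
  similarity r p := ⟨1 / (4 : ℕ), by positivity, daunTiling_isScaled r p⟩
  iUnion_piece r := by
    refine Subset.antisymm (iUnion_subset fun (p : Fin 16) => ?_) fun x hx => ?_
    · refine (daunTiling_piece p).trans_subset fun x hx => ?_
      obtain ⟨⟨h1, h2⟩, h3, h4⟩ := mem_tileBox_one.1 hx
      obtain ⟨h5, h6⟩ := daunTable_add_le p
      have h5' : ((daunTable p).1 : ℝ) + turnedWidth (daunTable p).2.2 ≤ 12 := by
        exact_mod_cast h5
      have h6' : ((daunTable p).2.1 : ℝ) + turnedHeight (daunTable p).2.2 ≤ 8 := by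
        exact_mod_cast h6
      have h7 : (0 : ℝ) ≤ (daunTable p).1 := by positivity
      have h8 : (0 : ℝ) ≤ (daunTable p).2.1 := by positivity
      exact ⟨⟨by linarith, by linarith⟩, by linarith, by linarith⟩
    · obtain ⟨⟨h1, h2⟩, h3, h4⟩ := hx
      obtain ⟨i, hi, hi1, hi2⟩ := exists_cell (M := 12) (by norm_num) (z := x 0 * 4)
        (by linarith) (by push_cast; linarith)
      obtain ⟨j, hj, hj1, hj2⟩ := exists_cell (M := 8) (by norm_num) (z := x 1 * 4)
        (by linarith) (by push_cast; linarith)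
      obtain ⟨p, ⟨hp1, hp2⟩, hp3, hp4⟩ := exists_piece_of_cell i hi j hj
      refine mem_iUnion.2 ⟨p, (daunTiling_piece p).superset (mem_tileBox_one.2 ?_)⟩
      exact ⟨⟨le_trans (by exact_mod_cast hp1) hi1, hi2.trans (by exact_mod_cast hp2)⟩,
        le_trans (by exact_mod_cast hp3) hj1, hj2.trans (by exact_mod_cast hp4)⟩
  disjoint_interior r := by
    intro (p : Fin 16) (q : Fin 16) hne
    rw [Set.disjoint_left]
    intro x hp hq
    obtain ⟨⟨h1, h2⟩, h3, h4⟩ := (interior_rectangle _ _ _ _).subset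
      (interior_mono (daunTiling_piece p).subset hp)
    obtain ⟨⟨h5, h6⟩, h7, h8⟩ := (interior_rectangle _ _ _ _).subset
      (interior_mono (daunTiling_piece q).subset hq)
    have contra : ∀ {a b c : ℕ} {z : ℝ}, z < ((a : ℝ) + b) / 4 ^ 1 → (c : ℝ) / 4 ^ 1 < z →
        ¬ a + b ≤ c := by
      intro a b c z h h' hle
      have : ((a : ℝ) + b) / 4 ^ 1 ≤ (c : ℝ) / 4 ^ 1 := by
        gcongr
        exact_mod_cast hle
      linarith
    rcases pieces_separated p q hne with h | h | h | h
    exacts [contra h2 h5 h, contra h6 h1 h, contra h4 h7 h,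
      contra h8 h3 h]

/-- The three pieces that meet at the point `(3 / 4, 1 / 2)`, with the cells that they
contain near this point. -/
theorem eq_of_cell_mem : ∀ q : Fin 16, ∀ s : Fin 3,
    (daunTable q).1 < ![3, 4, 3] s →
    ![2, 3, 2] s < (daunTable q).1 + turnedWidth (daunTable q).2.2 →
    (daunTable q).2.1 < ![2, 2, 3] s →
    ![1, 1, 2] s < (daunTable q).2.1 + turnedHeight (daunTable q).2.2 →
    q = ![0, 1, 5] s := by
  decide +kernel

theorem daunTiling_hasVertex : daunTiling.HasVertex 3 := by
  refine ⟨!₂[3 / 4, 1 / 2], ?_, fun ε hε => ?_⟩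
  · rw [← mem_interior_iff_mem_nhds]
    refine (interior_rectangle 0 3 0 2).superset ?_
    constructor <;> constructor <;> simp <;> norm_num
  change ∃ S : Finset (Fin 16), S.card = 3 ∧ _
  refine ⟨Finset.univ.map ⟨![0, 1, 5], by decide⟩, by simp, fun s hs => ?_⟩
  obtain ⟨i, -, rfl⟩ := Finset.mem_map.1 hs
  -- In quarter units the shift is at most 1/2, so each shifted point stays inside a unit cell
  -- touching the vertex.
  set δ := min (ε / 2) (1 / 8) with hδ
  have hδ0 : 0 < δ := by positivity
  have hδ1 : δ ≤ ε / 2 := min_le_left _ _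
  have hδ2 : δ ≤ 1 / 8 := min_le_right _ _
  refine ⟨!₂[3 / 4 + ![-δ, δ, -δ] i, 1 / 2 + ![-δ, -δ, δ] i], ?_, fun (q : Fin 16) hq => ?_⟩
  · refine Metric.mem_closedBall.2 (le_of_sq_le_sq ?_ hε.le)
    rw [EuclideanSpace.dist_eq, Real.sq_sqrt (by positivity), Fin.sum_univ_two]
    have : δ ^ 2 + δ ^ 2 ≤ ε ^ 2 := by nlinarith
    simp only [Real.dist_eq, sq_abs]
    fin_cases i <;> simpa using this
  · obtain ⟨⟨h1, h2⟩, h3, h4⟩ := mem_tileBox_one.1 ((daunTiling_piece q).subset hq)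
    have cast_lt : ∀ {m n : ℕ}, (m : ℝ) < n → m < n := fun h => by exact_mod_cast h
    refine eq_of_cell_mem q i (cast_lt (h1.trans_lt ?_)) (cast_lt (lt_of_lt_of_le ?_ (h2.trans ?_)))
      (cast_lt (h3.trans_lt ?_)) (cast_lt (lt_of_lt_of_le ?_ (h4.trans ?_)))
    pick_goal 3
    · push_cast; rfl
    pick_goal 5
    · push_cast; rfl
    all_goals fin_cases i <;> simp <;> linarith

/-! ### Cell types: the finite checks -/

/-- A unit cell of the grid on some level: the orientation of the tile of that level that contains
it, and the position of the cell in this tile (counting columns and rows from `0`). -/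
abbrev CellType : Type := Fin 4 × ℕ × ℕ

namespace CellType

/-- The possible types of cells. -/
def all : List CellType :=
  (List.finRange 4).flatMap fun q => (List.range (turnedWidth q)).flatMap fun u =>
    (List.range (turnedHeight q)).map fun v => (q, u, v)

/-- The cell is in the last column of its tile. -/
def atRight (c : CellType) : Bool := c.2.1 + 1 == turnedWidth c.1

/-- The cell is in the top row of its tile. -/
def atTop (c : CellType) : Bool := c.2.2 + 1 == turnedHeight c.1

/-- The piece at position `(X, Y)` in the subdivision of a tile of orientation `q`, where the
unit is the cell size of the next level. -/
def childAt (q : Fin 4) (X Y : ℕ) : Fin 16 :=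
  ((List.finRange 16).find? fun p =>
    let r := q + (daunTable p).2.2
    decide ((childCorner q p).1 ≤ X ∧ X < (childCorner q p).1 + turnedWidth r ∧
      (childCorner q p).2 ≤ Y ∧ Y < (childCorner q p).2 + turnedHeight r)).getD 0

/-- The type of the cell in column `s` and row `t` of the `4 × 4` cells of the next level that
subdivide a cell of type `c`. -/
def subcell (c : CellType) (s t : ℕ) : CellType :=
  let p := childAt c.1 (4 * c.2.1 + s) (4 * c.2.2 + t)
  (c.1 + (daunTable p).2.2, 4 * c.2.1 + s - (childCorner c.1 p).1,
    4 * c.2.2 + t - (childCorner c.1 p).2)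

/-- A relation that holds between the types of a cell and its right neighbour: they
are in the same tile, or on two sides of an edge, where cells are of two kinds that do not mix. -/
def Beside (c c' : CellType) : Bool :=
  c' == (c.1, c.2.1 + 1, c.2.2) ||
    (atRight c && c'.2.1 == 0 &&
      ([(0, 2, 0), (1, 1, 1), (2, 2, 1), (3, 1, 0), (3, 1, 2)].contains c ==
        [(0, 0, 1), (1, 0, 1), (2, 0, 0), (3, 0, 0), (3, 0, 2)].contains c'))

/-- A relation that holds between the types of a cell and its upper neighbour. -/
def Below (c c' : CellType) : Bool :=
  c' == (c.1, c.2.1, c.2.2 + 1) ||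
    (atTop c && c'.2.2 == 0 &&
      ([(0, 0, 1), (0, 2, 1), (1, 1, 2), (2, 1, 1), (3, 0, 2)].contains c ==
        [(0, 0, 0), (0, 2, 0), (1, 0, 0), (2, 1, 0), (3, 1, 0)].contains c'))

/-- Four tiles meet at the upper right corner of a cell of type `c`, if it has
right neighbour `cr` and upper neighbour `cu`. -/
def Crossing (c cr cu : CellType) : Bool := atRight c && atRight cu && atTop c && atTop cr

theorem lt_of_mem_all : ∀ c ∈ all, c.2.1 < turnedWidth c.1 ∧ c.2.2 < turnedHeight c.1 := by
  decide +kernel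

theorem root_mem_all : ∀ i < 3, ∀ j < 2, ((0, i, j) : CellType) ∈ all := by
  intro i hi j hj
  interval_cases i <;> interval_cases j <;> decide +kernel

theorem subcell_mem_all : ∀ c ∈ all, ∀ s < 4, ∀ t < 4, subcell c s t ∈ all := by decide +kernel

/-- Makes the truncated subtractions in `subcell` exact. Together with `subcell_mem_all` and
`lt_of_mem_all` it shows that the default value in `childAt` does no harm: the returned piece really
contains the cell. -/
theorem childCorner_childAt_le : ∀ c ∈ all, ∀ s < 4, ∀ t < 4,
    (childCorner c.1 (childAt c.1 (4 * c.2.1 + s) (4 * c.2.2 + t))).1 ≤ 4 * c.2.1 + s ∧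
    (childCorner c.1 (childAt c.1 (4 * c.2.1 + s) (4 * c.2.2 + t))).2 ≤ 4 * c.2.2 + t := by
  decide +kernel

theorem beside_subcell_self : ∀ c ∈ all, ∀ s < 3, ∀ t < 4,
    Beside (subcell c s t) (subcell c (s + 1) t) := by decide +kernel

theorem below_subcell_self : ∀ c ∈ all, ∀ s < 4, ∀ t < 3,
    Below (subcell c s t) (subcell c s (t + 1)) := by decide +kernel

/-- The two kinds of edge cells in `Beside` make it an invariant: coarse enough to be inherited
across an edge, fine enough for `not_crossing_of_beside`. -/
theorem beside_subcell : ∀ c ∈ all, ∀ c' ∈ all, Beside c c' → ∀ t < 4,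
    Beside (subcell c 3 t) (subcell c' 0 t) := by decide +kernel

theorem below_subcell : ∀ c ∈ all, ∀ c' ∈ all, Below c c' → ∀ s < 4,
    Below (subcell c s 3) (subcell c' s 0) := by decide +kernel

/-- The four checks from here on treat a grid corner inside a parent cell, on a vertical or a
horizontal side of it, and at a corner of it. Only the last needs the absence of a crossing one
level up; the diagonal neighbour never enters. -/
theorem not_crossing_subcell_self : ∀ c ∈ all, ∀ s < 3, ∀ t < 3,
    ¬ Crossing (subcell c s t) (subcell c (s + 1) t) (subcell c s (t + 1)) := by decide +kernel

theorem not_crossing_of_beside : ∀ c ∈ all, ∀ c' ∈ all, Beside c c' → ∀ t < 3,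
    ¬ Crossing (subcell c 3 t) (subcell c' 0 t) (subcell c 3 (t + 1)) := by decide +kernel

theorem not_crossing_of_below : ∀ c ∈ all, ∀ c' ∈ all, Below c c' → ∀ s < 3,
    ¬ Crossing (subcell c s 3) (subcell c (s + 1) 3) (subcell c' s 0) := by decide +kernel

theorem not_crossing_of_not_crossing : ∀ c ∈ all, ∀ cr ∈ all, Beside c cr → ∀ cu ∈ all,
    Below c cu → ¬ Crossing c cr cu →
    ¬ Crossing (subcell c 3 3) (subcell cr 0 3) (subcell cu 3 0) := by decide +kernel

end CellType

/-! ### Induction over the levels: no four tiles meet -/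

/-- The type of the cell in column `i` and row `j` of the grid on level `k`, where the unit tile
consists of `3 * 4 ^ k` columns and `2 * 4 ^ k` rows. -/
def cellType : ℕ → ℕ → ℕ → CellType
  | 0, i, j => (0, i, j)
  | k + 1, i, j => (cellType k (i / 4) (j / 4)).subcell (i % 4) (j % 4)

/-- The tile of level `k` that contains the cell in column `i` and row `j`. -/
def cellTile (k i j : ℕ) : Set (Space 2) :=
  tileBox k (cellType k i j).1 (i - (cellType k i j).2.1) (j - (cellType k i j).2.2)

theorem div_four_lt {m k i : ℕ} (h : i < m * 4 ^ (k + 1)) : i / 4 < m * 4 ^ k := by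
  rw [pow_succ, ← mul_assoc] at h
  omega

theorem div_mod_four_succ (i : ℕ) :
    (i % 4 < 3 ∧ (i + 1) / 4 = i / 4 ∧ (i + 1) % 4 = i % 4 + 1) ∨
      (i % 4 = 3 ∧ (i + 1) / 4 = i / 4 + 1 ∧ (i + 1) % 4 = 0) := by
  omega

theorem cellType_mem_all {k i j : ℕ} (hi : i < 3 * 4 ^ k) (hj : j < 2 * 4 ^ k) :
    cellType k i j ∈ CellType.all := by
  induction k generalizing i j with
  | zero => exact CellType.root_mem_all i (by simpa using hi) j (by simpa using hj)
  | succ k ih =>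
    exact CellType.subcell_mem_all _ (ih (div_four_lt hi) (div_four_lt hj)) _
      (Nat.mod_lt _ four_pos) _ (Nat.mod_lt _ four_pos)

theorem beside_cellType {k i j : ℕ} (hi : i + 1 < 3 * 4 ^ k) (hj : j < 2 * 4 ^ k) :
    CellType.Beside (cellType k i j) (cellType k (i + 1) j) := by
  induction k generalizing i j with
  | zero => simp [CellType.Beside, cellType]
  | succ k ih =>
    have hi1 := div_four_lt hi
    have hi0 := div_four_lt ((Nat.lt_succ_self i).trans hi)
    have hj0 := div_four_lt hj
    have hj4 := Nat.mod_lt j four_pos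
    simp only [cellType]
    rcases div_mod_four_succ i with ⟨h1, h2, h3⟩ | ⟨h1, h2, h3⟩
    · rw [h2, h3]
      exact CellType.beside_subcell_self _ (cellType_mem_all hi0 hj0) _ h1 _ hj4
    · rw [h2] at hi1
      rw [h1, h2, h3]
      exact CellType.beside_subcell _ (cellType_mem_all hi0 hj0) _ (cellType_mem_all hi1 hj0)
        (ih hi1 hj0) _ hj4

theorem below_cellType {k i j : ℕ} (hi : i < 3 * 4 ^ k) (hj : j + 1 < 2 * 4 ^ k) :
    CellType.Below (cellType k i j) (cellType k i (j + 1)) := by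
  induction k generalizing i j with
  | zero => simp [CellType.Below, cellType]
  | succ k ih =>
    have hj1 := div_four_lt hj
    have hj0 := div_four_lt ((Nat.lt_succ_self j).trans hj)
    have hi0 := div_four_lt hi
    have hi4 := Nat.mod_lt i four_pos
    simp only [cellType]
    rcases div_mod_four_succ j with ⟨h1, h2, h3⟩ | ⟨h1, h2, h3⟩
    · rw [h2, h3]
      exact CellType.below_subcell_self _ (cellType_mem_all hi0 hj0) _ hi4 _ h1
    · rw [h2] at hj1
      rw [h1, h2, h3]
      exact CellType.below_subcell _ (cellType_mem_all hi0 hj0) _ (cellType_mem_all hi0 hj1)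
        (ih hi0 hj1) _ hi4

theorem not_crossing_cellType {k i j : ℕ} (hi : i + 1 < 3 * 4 ^ k) (hj : j + 1 < 2 * 4 ^ k) :
    ¬ CellType.Crossing (cellType k i j) (cellType k (i + 1) j) (cellType k i (j + 1)) := by
  induction k generalizing i j with
  | zero =>
    have : j = 0 := by omega
    subst this
    simp [CellType.Crossing, CellType.atTop, cellType, turnedHeight]
  | succ k ih =>
    have hi1 := div_four_lt hi
    have hi0 := div_four_lt ((Nat.lt_succ_self i).trans hi)
    have hj1 := div_four_lt hj
    have hj0 := div_four_lt ((Nat.lt_succ_self j).trans hj)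
    simp only [cellType]
    rcases div_mod_four_succ i with ⟨h1, h2, h3⟩ | ⟨h1, h2, h3⟩ <;>
      rcases div_mod_four_succ j with ⟨h4, h5, h6⟩ | ⟨h4, h5, h6⟩ <;> rw [h2, h3, h5, h6]
    · exact CellType.not_crossing_subcell_self _ (cellType_mem_all hi0 hj0) _ h1 _ h4
    · rw [h5] at hj1
      rw [h4]
      exact CellType.not_crossing_of_below _ (cellType_mem_all hi0 hj0) _
        (cellType_mem_all hi0 hj1) (below_cellType hi0 hj1) _ h1
    · rw [h2] at hi1
      rw [h1]
      exact CellType.not_crossing_of_beside _ (cellType_mem_all hi0 hj0) _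
        (cellType_mem_all hi1 hj0) (beside_cellType hi1 hj0) _ h4
    · rw [h2] at hi1
      rw [h5] at hj1
      rw [h1, h4]
      exact CellType.not_crossing_of_not_crossing _ (cellType_mem_all hi0 hj0) _
        (cellType_mem_all hi1 hj0) (beside_cellType hi1 hj0) _ (cellType_mem_all hi0 hj1)
        (below_cellType hi0 hj1) (ih hi1 hj1)

theorem isPlacement_cellType {k i j : ℕ} (hi : i < 3 * 4 ^ k) (hj : j < 2 * 4 ^ k) :
    IsPlacement k (cellType k i j).1 (i - (cellType k i j).2.1) (j - (cellType k i j).2.2) := by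
  induction k generalizing i j with
  | zero => simpa [cellType] using isPlacement_zero
  | succ k ih =>
    have hi0 := div_four_lt hi
    have hj0 := div_four_lt hj
    have h := ih hi0 hj0
    have hle := CellType.childCorner_childAt_le _ (cellType_mem_all hi0 hj0) _
      (Nat.mod_lt i four_pos) _ (Nat.mod_lt j four_pos)
    simp only [cellType, CellType.subcell]
    set c := cellType k (i / 4) (j / 4)
    set p := CellType.childAt c.1 (4 * c.2.1 + i % 4) (4 * c.2.2 + j % 4)
    have hi4 : (4 : ℝ) * (i / 4 : ℕ) + (i % 4 : ℕ) = i := by exact_mod_cast Nat.div_add_mod i 4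
    have hj4 : (4 : ℝ) * (j / 4 : ℕ) + (j % 4 : ℕ) = j := by exact_mod_cast Nat.div_add_mod j 4
    convert h.succ p using 1
    · rw [Nat.cast_sub hle.1]
      push_cast
      linarith
    · rw [Nat.cast_sub hle.2]
      push_cast
      linarith

theorem cellTile_mem_levelTiles {k i j : ℕ} (hi : i < 3 * 4 ^ k) (hj : j < 2 * 4 ^ k) :
    cellTile k i j ∈ daunTiling.levelTiles k :=
  (isPlacement_cellType hi hj).tileBox_mem

theorem mem_cellTile {k i j : ℕ} (hi : i < 3 * 4 ^ k) (hj : j < 2 * 4 ^ k) {x : Space 2}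
    (h0 : x 0 * 4 ^ k ∈ Icc (i : ℝ) (i + 1)) (h1 : x 1 * 4 ^ k ∈ Icc (j : ℝ) (j + 1)) :
    x ∈ cellTile k i j := by
  have hk : (0 : ℝ) < 4 ^ k := by positivity
  obtain ⟨hu, hv⟩ := CellType.lt_of_mem_all _ (cellType_mem_all hi hj)
  have hu' : ((cellType k i j).2.1 : ℝ) + 1 ≤ turnedWidth (cellType k i j).1 := by
    exact_mod_cast hu
  have hv' : ((cellType k i j).2.2 : ℝ) + 1 ≤ turnedHeight (cellType k i j).1 := by
    exact_mod_cast hv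
  have hu0 : (0 : ℝ) ≤ (cellType k i j).2.1 := by positivity
  have hv0 : (0 : ℝ) ≤ (cellType k i j).2.2 := by positivity
  simp only [cellTile, tileBox, mem_ofPred_eq, mem_Icc, div_le_iff₀ hk, le_div_iff₀ hk]
  exact ⟨⟨by linarith [h0.1], by linarith [h0.2]⟩, by linarith [h1.1], by linarith [h1.2]⟩

/-- Off the last column, only the same-tile alternative of `Beside` survives, and both cells yield
the same corner. -/
theorem cellTile_succ_left {k i j : ℕ} (hi : i + 1 < 3 * 4 ^ k) (hj : j < 2 * 4 ^ k)
    (h : ¬ (cellType k i j).atRight) : cellTile k (i + 1) j = cellTile k i j := by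
  have hb := beside_cellType hi hj
  simp only [CellType.Beside, Bool.eq_false_of_not_eq_true h, Bool.false_and, Bool.or_false,
    beq_iff_eq] at hb
  simp [cellTile, hb]

theorem cellTile_succ_right {k i j : ℕ} (hi : i < 3 * 4 ^ k) (hj : j + 1 < 2 * 4 ^ k)
    (h : ¬ (cellType k i j).atTop) : cellTile k i (j + 1) = cellTile k i j := by
  have hb := below_cellType hi hj
  simp only [CellType.Below, Bool.eq_false_of_not_eq_true h, Bool.false_and, Bool.or_false,
    beq_iff_eq] at hb
  simp [cellTile, hb]

open scoped Classical in
-- Without a crossing, one of the four grid edges at the common corner is not a tile boundary, so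
-- two of the four tiles coincide. A degenerate block has a repetition anyway.
theorem card_cellTiles_le {k i i' j j' : ℕ} (hi : i' = i ∨ i' = i + 1) (hj : j' = j ∨ j' = j + 1)
    (hi' : i' < 3 * 4 ^ k) (hj' : j' < 2 * 4 ^ k) :
    ({cellTile k i j, cellTile k i' j, cellTile k i j', cellTile k i' j'} :
      Finset (Set (Space 2))).card ≤ 3 := by
  have key : cellTile k i' j = cellTile k i j ∨ cellTile k i' j' = cellTile k i j' ∨
      cellTile k i j' = cellTile k i j ∨ cellTile k i' j' = cellTile k i' j := by
    rcases hi with rfl | rfl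
    · exact Or.inl rfl
    rcases hj with rfl | rfl
    · exact Or.inr (Or.inr (Or.inl rfl))
    have h := not_crossing_cellType hi' hj'
    simp only [CellType.Crossing, Bool.and_eq_true, not_and_or, or_assoc] at h
    rcases h with h | h | h | h
    · exact Or.inl (cellTile_succ_left hi' (by omega) h)
    · exact Or.inr (Or.inl (cellTile_succ_left hi' hj' h))
    · exact Or.inr (Or.inr (Or.inl (cellTile_succ_right (by omega) hj' h)))
    · exact Or.inr (Or.inr (Or.inr (cellTile_succ_right hi' hj' h)))
  rcases key with h | h | h | h <;> rw [h]
  · rw [Finset.insert_eq_of_mem (by simp)]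
    exact Finset.card_le_three
  · rw [Finset.pair_eq_singleton]
    exact Finset.card_le_three
  · rw [Finset.insert_eq_of_mem (by simp)]
    exact Finset.card_le_three
  · rw [Finset.insert_eq_of_mem (a := cellTile k i' j) (by simp)]
    exact Finset.card_le_three

/-! ### Covering small balls by three Daun tiles -/

theorem daunTiling_locallyCovers : daunTiling.LocallyCovers 4 3 := by
  classical
  -- In cell units the ball then has width at most 1/2, as `exists_two_cells` demands.
  refine ⟨1 / 4, by norm_num, fun k x r hr hle hx => ?_⟩
  have hk : (0 : ℝ) < 4 ^ k := by positivity
  push_cast at hle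
  have hrk : 0 < r * 4 ^ k := by positivity
  have hunit : ∀ y ∈ Metric.closedBall x r, y 0 * 4 ^ k ∈ Icc (0 : ℝ) ((3 * 4 ^ k : ℕ) : ℝ) ∧
      y 1 * 4 ^ k ∈ Icc (0 : ℝ) ((2 * 4 ^ k : ℕ) : ℝ) := by
    intro y hy
    obtain ⟨⟨h1, h2⟩, h3, h4⟩ := hx hy
    push_cast
    refine ⟨⟨?_, ?_⟩, ?_, ?_⟩
    exacts [by positivity, by gcongr, by positivity, by gcongr]
  have hnear : ∀ y ∈ Metric.closedBall x r, ∀ i : Fin 2,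
      (x i - r) * 4 ^ k ≤ y i * 4 ^ k ∧ y i * 4 ^ k ≤ (x i + r) * 4 ^ k := by
    intro y hy i
    have h1 : ‖(y - x) i‖ ≤ ‖y - x‖ := PiLp.norm_apply_le _ i
    have h2 := abs_le.1 (h1.trans (by simpa [dist_eq_norm] using hy))
    simp only [PiLp.sub_apply] at h2
    constructor <;> gcongr <;> linarith
  -- The interval is clamped to `[0, M]` to keep the cell indices inside the grid; nothing is lost
  -- because the ball lies in the unit tile.
  have hcells : ∀ (i : Fin 2) (M : ℕ), x i * 4 ^ k ≤ M → 0 ≤ x i * 4 ^ k → 0 < M →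
      ∃ m m' : ℕ, (m' = m ∨ m' = m + 1) ∧ m < M ∧ m' < M ∧
        ∀ z ∈ Icc (max 0 ((x i - r) * 4 ^ k)) (min (M : ℝ) ((x i + r) * 4 ^ k)),
          z ∈ Icc (m : ℝ) (m + 1) ∨ z ∈ Icc (m' : ℝ) (m' + 1) := by
    intro i M hM h0 hM0
    refine exists_two_cells (le_max_left _ _) (max_lt (by exact_mod_cast hM0) (by linarith)) ?_
      (min_le_left _ _)
    refine (min_le_right _ _).trans ?_
    have := le_max_right 0 ((x i - r) * 4 ^ k)
    linarith
  obtain ⟨⟨hx1, hx2⟩, hx3, hx4⟩ := hunit x (Metric.mem_closedBall_self hr.le)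
  obtain ⟨i, i', hi, hi1, hi2, hiz⟩ := hcells 0 _ hx2 hx1 (by positivity)
  obtain ⟨j, j', hj, hj1, hj2, hjz⟩ := hcells 1 _ hx4 hx3 (by positivity)
  refine ⟨{cellTile k i j, cellTile k i' j, cellTile k i j', cellTile k i' j'}, ?_,
    card_cellTiles_le hi hj hi2 hj2, fun y hy => ?_⟩
  · intro t ht
    simp only [Finset.mem_insert, Finset.mem_singleton] at ht
    rcases ht with rfl | rfl | rfl | rfl
    exacts [cellTile_mem_levelTiles hi1 hj1, cellTile_mem_levelTiles hi2 hj1,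
      cellTile_mem_levelTiles hi1 hj2, cellTile_mem_levelTiles hi2 hj2]
  · obtain ⟨hy0, hy1⟩ := hunit y hy
    have h0 := hiz (y 0 * 4 ^ k) ⟨max_le hy0.1 (hnear y hy 0).1, le_min hy0.2 (hnear y hy 0).2⟩
    have h1 := hjz (y 1 * 4 ^ k) ⟨max_le hy1.1 (hnear y hy 1).1, le_min hy1.2 (hnear y hy 1).2⟩
    simp only [mem_iUnion, Finset.mem_insert, Finset.mem_singleton, exists_prop,
      exists_eq_or_imp, exists_eq_left]
    rcases h0 with h0 | h0 <;> rcases h1 with h1 | h1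
    exacts [Or.inl (mem_cellTile hi1 hj1 h0 h1),
      Or.inr (Or.inr (Or.inl (mem_cellTile hi1 hj2 h0 h1))),
      Or.inr (Or.inl (mem_cellTile hi2 hj1 h0 h1)),
      Or.inr (Or.inr (Or.inr (mem_cellTile hi2 hj2 h0 h1)))]

/-! ### Layers, counting and conclusion -/

namespace RecursiveTiling

variable {d : ℕ}

theorem prism_injective {lo hi : ℝ} (h : lo ≤ hi) :
    Function.Injective fun t : Set (Space d) => prism t lo hi := by
  intro t t' htt
  ext x
  have := Set.ext_iff.1 htt (appendLast x lo)
  simpa [h] using this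

theorem levelTiles_one (T : RecursiveTiling d) : T.levelTiles 1 = range (T.piece T.root) := by
  ext t
  constructor
  · rintro ⟨p, s, hs, rfl⟩
    obtain rfl : s = T.region (T.next T.root p) := hs
    exact ⟨p, rfl⟩
  · rintro ⟨p, rfl⟩
    exact ⟨p, _, rfl, rfl⟩

/-- All layers have the same thickness, so a nonempty prism of layer `m` fits in the slab of layer
`l` only if `m = l`; nonemptiness of the bases is what allows heights to be compared. -/
theorem lift_levelTiles_one_layer {T : RecursiveTiling d} (hT : T.IsValid)
    (hne : ∀ t ∈ T.levelTiles 1, t.Nonempty) {k : ℕ} (hk : 0 < k) {h : ℝ} (hh : 0 < h)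
    (l : Fin k) :
    {s ∈ (T.lift k h).levelTiles 1 |
      s ⊆ prism T.unitTile ((l : ℕ) * h / k) (((l : ℕ) + 1) * h / k)} =
    (fun t => prism t ((l : ℕ) * h / k) (((l : ℕ) + 1) * h / k)) '' T.levelTiles 1 := by
  have hk' : (0 : ℝ) < k := by exact_mod_cast hk
  rw [lift_levelTiles T hk]
  simp only [pow_one]
  ext s
  constructor
  · rintro ⟨⟨t, ht, m, hm, rfl⟩, hsub⟩
    obtain ⟨x, hx⟩ := hne t ht
    have hle : (m : ℝ) * h / k ≤ (m + 1) * h / k := by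
      gcongr
      linarith
    have h1 := (appendLast_mem_prism.1 (hsub (appendLast_mem_prism.2 ⟨hx, le_rfl, hle⟩))).2.1
    have h2 := (appendLast_mem_prism.1 (hsub (appendLast_mem_prism.2 ⟨hx, hle, le_rfl⟩))).2.2
    rw [div_le_div_iff_of_pos_right hk', mul_le_mul_iff_left₀ hh] at h1 h2
    have h1' : (l : ℕ) ≤ m := by exact_mod_cast h1
    have h2' : m + 1 ≤ (l : ℕ) + 1 := by exact_mod_cast h2
    obtain rfl : m = l := by omega
    exact ⟨t, ht, rfl⟩
  · rintro ⟨t, ht, rfl⟩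
    exact ⟨⟨t, ht, l, l.2, rfl⟩, fun x hx => ⟨tilesFrom_subset_region hT 1 _ ht hx.1, hx.2⟩⟩

end RecursiveTiling

theorem interior_tileBox_nonempty (k : ℕ) (q : Fin 4) (A B : ℝ) :
    (interior (tileBox k q A B)).Nonempty := by
  obtain ⟨a, b, hab, h⟩ := isBox_tileBox k q A B
  have h' : tileBox k q A B =
      {x : Space 2 | x 0 ∈ Icc (a 0) (b 0) ∧ x 1 ∈ Icc (a 1) (b 1)} := by
    simp only [h, Fin.forall_fin_two]
  refine ⟨!₂[(a 0 + b 0) / 2, (a 1 + b 1) / 2], ?_⟩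
  rw [h', interior_rectangle]
  have h0 := hab 0
  have h1 := hab 1
  simp only [mem_ofPred_eq, mem_Ioo, Matrix.cons_val_zero, Matrix.cons_val_one]
  exact ⟨⟨by linarith, by linarith⟩, by linarith, by linarith⟩

/-- Two equal pieces with different indices would have disjoint, hence empty, interiors. -/
theorem daunTiling_ncard_levelTiles_one : (daunTiling.levelTiles 1).ncard = 16 := by
  have hinj : Function.Injective (daunTiling.piece ()) := by
    intro (p : Fin 16) (q : Fin 16) hpq
    by_contra hne
    have hdisj := daunTiling_isValid.disjoint_interior () p q hne
    rw [← hpq, disjoint_self, daunTiling_piece p] at hdisj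
    exact (interior_tileBox_nonempty _ _ _ _).ne_empty hdisj
  rw [RecursiveTiling.levelTiles_one, ← image_univ]
  refine (ncard_image_of_injective univ hinj).trans ?_
  rw [ncard_univ]
  exact (Nat.card_eq_fintype_card (α := Fin 16)).trans rfl

theorem liftedDaunTiling_properties (n : ℕ) (h : Fin n → ℝ) (hh : ∀ i, 0 < h i) :
    (liftedDaunTiling n h).IsValid ∧ (liftedDaunTiling n h).IsScaled 4 ∧
      (liftedDaunTiling n h).IsRectangular ∧ (liftedDaunTiling n h).LocallyCovers 4 (3 * 2 ^ n) ∧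
      (liftedDaunTiling n h).HasVertex (3 * 2 ^ n) := by
  induction n with
  | zero =>
    exact ⟨daunTiling_isValid, daunTiling_isScaled, daunTiling_isRectangular,
      daunTiling_locallyCovers, daunTiling_hasVertex⟩
  | succ n ih =>
    obtain ⟨h1, h2, h3, h4, h5⟩ := ih (fun i => h i.castSucc) fun i => hh i.castSucc
    have hl := hh (Fin.last n)
    rw [show 3 * 2 ^ (n + 1) = 2 * (3 * 2 ^ n) by ring]
    exact ⟨h1.lift four_pos h2 hl, h2.lift _, h3.lift four_pos hl, h4.lift four_pos hl,
      h5.lift (by norm_num) hl⟩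

theorem liftedDaunTiling_hasArrwwidNumber (n : ℕ) (h : Fin n → ℝ) (hh : ∀ i, 0 < h i) :
    (liftedDaunTiling n h).HasArrwwidNumber (3 * 2 ^ n) := by
  obtain ⟨h1, h2, -, h4, h5⟩ := liftedDaunTiling_properties n h hh
  exact RecursiveTiling.hasArrwwidNumber_of_locallyCovers_of_hasVertex (by omega) (by norm_num)
    (by positivity) h1 h2 h4 h5

end

theorem mainTheorem9 :
    -- the three-dimensional lifted Daun tiling, with a unit tile of any height `h`
    (∀ h : ℝ, 0 < h →
      (liftedDaunTiling 1 fun _ => h).IsValid ∧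
      (liftedDaunTiling 1 fun _ => h).IsRectangular ∧
      -- 64 boxes per box
      (∀ r, Nat.card ((liftedDaunTiling 1 fun _ => h).Piece r) = 64) ∧
      -- they form four equal layers of sixteen boxes, and each layer is a Daun tiling
      (∀ l : Fin 4,
        {s ∈ (liftedDaunTiling 1 fun _ => h).levelTiles 1 |
            s ⊆ RecursiveTiling.prism daunTiling.unitTile
              ((l : ℕ) * h / 4) (((l : ℕ) + 1) * h / 4)} =
          (fun t => RecursiveTiling.prism t ((l : ℕ) * h / 4) (((l : ℕ) + 1) * h / 4)) ''
            daunTiling.levelTiles 1 ∧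
        {s ∈ (liftedDaunTiling 1 fun _ => h).levelTiles 1 |
            s ⊆ RecursiveTiling.prism daunTiling.unitTile
              ((l : ℕ) * h / 4) (((l : ℕ) + 1) * h / 4)}.ncard = 16) ∧
      (liftedDaunTiling 1 fun _ => h).HasArrwwidNumber 6) ∧
    -- the lifted Daun tiling in any dimension `d = 2 + n`
    (∀ (n : ℕ) (h : Fin n → ℝ), (∀ i, 0 < h i) →
      (liftedDaunTiling n h).IsValid ∧
      (liftedDaunTiling n h).IsRectangular ∧
      (liftedDaunTiling n h).HasArrwwidNumber (3 * 2 ^ n)) := by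
  refine ⟨fun h hh => ?_, fun n h hh => ?_⟩
  · obtain ⟨h1, -, h3, -, -⟩ := liftedDaunTiling_properties 1 (fun _ => h) fun _ => hh
    have hne : ∀ t ∈ daunTiling.levelTiles 1, t.Nonempty := by
      intro t ht
      rw [RecursiveTiling.levelTiles_one] at ht
      obtain ⟨p, rfl⟩ := ht
      refine ((interior_tileBox_nonempty _ _ _ _).mono interior_subset).mono
        (daunTiling_piece p).superset
    refine ⟨h1, h3, fun _ => ?_, fun l => ?_, liftedDaunTiling_hasArrwwidNumber 1 _ fun _ => hh⟩
    · exact (Nat.card_eq_fintype_card (α := Fin 16 × Fin 4)).trans rfl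
    · have hlayer := RecursiveTiling.lift_levelTiles_one_layer daunTiling_isValid hne
        four_pos hh l
      have hle : (l : ℕ) * h / 4 ≤ ((l : ℕ) + 1) * h / 4 := by
        gcongr
        linarith
      refine ⟨hlayer, (congrArg ncard hlayer).trans ?_⟩
      refine (ncard_image_of_injective _ (RecursiveTiling.prism_injective hle)).trans ?_
      exact daunTiling_ncard_levelTiles_one
  · obtain ⟨h1, -, h3, -, -⟩ := liftedDaunTiling_properties n h hh
    exact ⟨h1, h3, liftedDaunTiling_hasArrwwidNumber n h hh⟩
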